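/- **Setting.** A *program* (fair transition system) $D=(v,\mathit{init}(v),\mathit{next}(v,v'),J)$ consists of a tuple $v$ of variables, an initial condition, a transition relation and a finite list $J=(J_1,\dots,J_{|J|})$ of assertions over $v$ (fairness conditions). States are valuations of $v$; a *path* is an infinite sequence of states in which consecutive states satisfy $\mathit{next}$; it is *fair* if every $J_i$ holds infinitely often along it. CTL$^*$ *formulas* in negation normal form are the state formulas of the grammar $$\varphi ::= c \mid \varphi\wedge\varphi \mid \varphi\vee\varphi \mid A\psi \mid E\psi \mid A_f\psi \mid E_f\psi ,\qquad \psi ::= \varphi \mid \psi\wedge\psi\mid\psi\vee\psi\mid X\psi\mid G\psi\mid \psi U\psi ,$$ where $c$ ranges over assertions (negation occurs only inside assertions; a Boolean combination of assertions is an assertion). $A,E$ quantify over all paths, $A_f,E_f$ over all fair paths, that start in the given state; $X,G,U$ have the usual semantics. $D\models\varphi$ means that every initial state of $D$ satisfies $\varphi$. A *basic* state formula is $Q\psi$ with $Q$ a path quantifier and $\psi$ free of path quantifiers. An *Existential Horn Clause* is either a universally closed implication between constraints that may contain uninterpreted predicates and, in its head, existential quantifiers, or a clause $\mathit{dwf}(r)$,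 which says that the relation $r$ is disjunctively well-founded, i.e. contained in a finite union of relations without infinite chains $x_0\,R\,x_1\,R\,x_2\cdots$. A set of clauses is *satisfiable* if some interpretation of the uninterpreted predicates as relations makes all its clauses true. **Translation.** The translation system $\mathsf{Trans}$ produces sets $\mathit{Clauses}(D,\varphi)$ by the following rules, applied in any possible order; all introduced predicates and variables are fresh, and programs and formulas that arise on the way may contain the predicates and Boolean variables introduced before. Here $D=(v,\mathit{init},\mathit{next},J)$, and $c,c_1,c_2$ are assertions. 1. If a basic state formula $\varphi_1$ occurs in the state formula $\varphi_2(\varphi_1)$: $\mathit{Clauses}(D,\varphi_2(\varphi_1))=\mathit{Clauses}((v,\mathit{aux}(v),\mathit{next},J),\varphi_1)\cup\mathit{Clauses}(D,\varphi_2(\mathit{aux}(v)))$, where all occurrences of $\varphi_1$ are replaced. 2. For basic $A\psi$, $E\psi$: $\mathit{Clauses}(D,A\psi)=\mathit{Clauses}((v,\mathit{init},\mathit{next},\emptyset),A_f\psi)$, and $\mathit{Clauses}(D,E\psi)=\mathit{Clauses}((v,\mathit{init},\mathit{next},\emptyset),E_f\psi)$. 3. If $Xc$ occurs in $\psi$,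 where $A_f\psi(Xc)$ resp. $E_f\psi(Xc)$ is basic, let $x$ be a new Boolean variable, $N=\mathit{next}(v,v')\wedge(x\leftrightarrow c(v'))$ and $J^+=J$. Then, with all occurrences of $Xc$ replaced by $x$, $$\mathit{Clauses}(D,A_f\psi(Xc))=\mathit{Clauses}((v\cup\{x\},\mathit{init}(v),N,J^+),A_f\psi(x)),$$ $$\mathit{Clauses}(D,E_f\psi(Xc))=\{\mathit{init}(v)\to\exists x:\mathit{aux}(v,x)\}\cup\mathit{Clauses}((v\cup\{x\},\mathit{aux}(v,x),N,J^+),E_f\psi(x)).$$ 4. The same for $Gc$ in place of $Xc$, with $N=\mathit{next}(v,v')\wedge(x\leftrightarrow(c(v)\wedge x'))$ and $J^+=J\cup\{x\vee\neg c(v)\}$. 5. The same for $c_1Uc_2$, with $N=\mathit{next}(v,v')\wedge(x\leftrightarrow(c_2(v)\vee(c_1(v)\wedge x')))$ and $J^+=J\cup\{\neg x\vee c_2(v)\}$. 6. $\mathit{Clauses}(D,A_fc)$ consists of $\mathit{init}(v)\wedge\neg c(v)\to p(v)$; $\mathit{next}(v,v')\wedge p(v)\to p(v')$; $\mathit{dwf}(r)$;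 $\mathit{next}(v,v')\to t(v,v')$; $t(v,v')\wedge\mathit{next}(v',v'')\to t(v,v'')$; and, if $J\neq\emptyset$, $p(v_0)\wedge\bigwedge_{i=1}^{|J|}(t(v_{i-1},v_i)\wedge J_i(v_i))\to r(v_0,v_{|J|})$, or, if $J=\emptyset$, $p(v)\wedge t(v,v')\to r(v,v')$. 7. If $J\ne\emptyset$, $\mathit{Clauses}(D,E_fc)$ consists of $\mathit{init}(v)\to c(v)\wedge q_1(v)$ and, for each $1\le i\le|J|$, of $q_i(v)\to\exists v':\mathit{next}(v,v')\wedge\big((J_i(v)\wedge q_{(i\bmod|J|)+1}(v'))\vee(r_i(v,v')\wedge q_i(v'))\big)$, $\mathit{dwf}(r_i)$, and $r_i(v,v')\wedge r_i(v',v'')\to r_i(v,v'')$. If $J=\emptyset$, it consists of $\mathit{init}(v)\to c(v)\wedge q(v)$ and $q(v)\to\exists v':\mathit{next}(v,v')\wedge q(v')$. 8. $\mathit{Clauses}(D,c)=\{\mathit{init}(v)\to c(v)\}$. **Theorem (soundness).** Let $D$ be a program and $\varphi$ a CTL$^*$ formula in negation normal form, both without uninterpreted predicates. If some set of clauses $\mathit{Clauses}(D,\varphi)$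 produced by $\mathsf{Trans}$ is satisfiable, then $D\models\varphi$. -/

import Mathlib

/-!
Fair transition systems, CTL* in negation normal form, Existential Horn Clauses over uninterpreted
predicates, and the translation of verification problems into sets of Existential Horn Clauses.

`S` is the set of valuations of the program variables `v`.  An assertion of the background theory
is given by its meaning, a set of valuations.
-/

namespace EHC

universe u

/-! ### Fair transition systems and CTL* -/

/-- A fair transition system `(v, init, next, J)` whose states are the elements of `X`;
`fair` enumerates the finitely many fairness conditions `J_1, …, J_{|J|}`. -/
structure FTS (X : Type u) where
  init : X → Prop
  next : X → X → Prop
  fair : List (X → Prop)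

/-- `π` is a path of `D`: an infinite sequence of states following `next`. -/
def FTS.IsPath {X : Type u} (D : FTS X) (π : ℕ → X) : Prop :=
  ∀ i, D.next (π i) (π (i + 1))

/-- `π` is a fair path of `D`: each fairness condition holds infinitely often along it. -/
def FTS.IsFairPath {X : Type u} (D : FTS X) (π : ℕ → X) : Prop :=
  D.IsPath π ∧ ∀ J ∈ D.fair, ∀ i, ∃ j, i ≤ j ∧ J (π j)

/-- The path quantifiers `A`, `E` and their fair versions `A_f`, `E_f`. -/
inductive Quant where
  | A
  | E
  | Af
  | Ef

mutual
/-- CTL* state formulas in negation normal form; `A` is the type of assertions.  Negation may be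
used inside assertions only. -/
inductive StateFormula (A : Type u) : Type u where
  | asrt (c : A)
  | and (φ₁ φ₂ : StateFormula A)
  | or (φ₁ φ₂ : StateFormula A)
  | quant (Q : Quant) (ψ : PathFormula A)
/-- CTL* path formulas in negation normal form. -/
inductive PathFormula (A : Type u) : Type u where
  | state (φ : StateFormula A)
  | and (ψ₁ ψ₂ : PathFormula A)
  | or (ψ₁ ψ₂ : PathFormula A)
  | next (ψ : PathFormula A)
  | glob (ψ : PathFormula A)
  | untl (ψ₁ ψ₂ : PathFormula A)
end

mutual
/-- `D, s ⊨ φ` for a state `s` and a state formula `φ`. -/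
def StateFormula.Sat {X : Type u} (D : FTS X) : StateFormula (X → Prop) → X → Prop
  | .asrt c, s => c s
  | .and φ₁ φ₂, s => φ₁.Sat D s ∧ φ₂.Sat D s
  | .or φ₁ φ₂, s => φ₁.Sat D s ∨ φ₂.Sat D s
  | .quant .A ψ, s => ∀ π : ℕ → X, D.IsPath π → π 0 = s → ψ.Sat D π
  | .quant .E ψ, s => ∃ π : ℕ → X, D.IsPath π ∧ π 0 = s ∧ ψ.Sat D π
  | .quant .Af ψ, s => ∀ π : ℕ → X, D.IsFairPath π → π 0 = s → ψ.Sat D π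
  | .quant .Ef ψ, s => ∃ π : ℕ → X, D.IsFairPath π ∧ π 0 = s ∧ ψ.Sat D π
/-- `D, π ⊨ ψ` for a sequence `π` of states and a path formula `ψ`. -/
def PathFormula.Sat {X : Type u} (D : FTS X) : PathFormula (X → Prop) → (ℕ → X) → Prop
  | .state φ, π => φ.Sat D (π 0)
  | .and ψ₁ ψ₂, π => ψ₁.Sat D π ∧ ψ₂.Sat D π
  | .or ψ₁ ψ₂, π => ψ₁.Sat D π ∨ ψ₂.Sat D π
  | .next ψ, π => ψ.Sat D (fun i => π (i + 1))
  | .glob ψ, π => ∀ k, ψ.Sat D (fun i => π (i + k))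
  | .untl ψ₁ ψ₂, π => ∃ k, ψ₂.Sat D (fun i => π (i + k)) ∧
      ∀ j, j < k → ψ₁.Sat D (fun i => π (i + j))
end

/-- `D ⊨ φ`: every initial state of `D` satisfies the state formula `φ`. -/
def FTS.Satisfies {X : Type u} (D : FTS X) (φ : StateFormula (X → Prop)) : Prop :=
  ∀ s, D.init s → φ.Sat D s

/-! ### Syntactic operations on CTL* formulas -/

mutual
/-- Apply `f` to all assertions of a state formula. -/
def StateFormula.map {A B : Type u} (f : A → B) : StateFormula A → StateFormula B
  | .asrt c => .asrt (f c)
  | .and φ₁ φ₂ => .and (φ₁.map f) (φ₂.map f)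
  | .or φ₁ φ₂ => .or (φ₁.map f) (φ₂.map f)
  | .quant Q ψ => .quant Q (ψ.map f)
/-- Apply `f` to all assertions of a path formula. -/
def PathFormula.map {A B : Type u} (f : A → B) : PathFormula A → PathFormula B
  | .state φ => .state (φ.map f)
  | .and ψ₁ ψ₂ => .and (ψ₁.map f) (ψ₂.map f)
  | .or ψ₁ ψ₂ => .or (ψ₁.map f) (ψ₂.map f)
  | .next ψ => .next (ψ.map f)
  | .glob ψ => .glob (ψ.map f)
  | .untl ψ₁ ψ₂ => .untl (ψ₁.map f) (ψ₂.map f)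
end

mutual
/-- The state formula contains no path quantifier. -/
def StateFormula.QuantFree {A : Type u} : StateFormula A → Prop
  | .asrt _ => True
  | .and φ₁ φ₂ => φ₁.QuantFree ∧ φ₂.QuantFree
  | .or φ₁ φ₂ => φ₁.QuantFree ∧ φ₂.QuantFree
  | .quant _ _ => False
/-- The path formula contains no path quantifier; then `Q ψ` is a basic state formula. -/
def PathFormula.QuantFree {A : Type u} : PathFormula A → Prop
  | .state φ => φ.QuantFree
  | .and ψ₁ ψ₂ => ψ₁.QuantFree ∧ ψ₂.QuantFree
  | .or ψ₁ ψ₂ => ψ₁.QuantFree ∧ ψ₂.QuantFree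
  | .next ψ => ψ.QuantFree
  | .glob ψ => ψ.QuantFree
  | .untl ψ₁ ψ₂ => ψ₁.QuantFree ∧ ψ₂.QuantFree
end

mutual
/-- The state formula `Q ψ` occurs in the state formula `φ`. -/
def StateFormula.Contains {A : Type u} (φ : StateFormula A) (Q : Quant) (ψ : PathFormula A) :
    Prop :=
  match φ with
  | .asrt _ => False
  | .and φ₁ φ₂ => φ₁.Contains Q ψ ∨ φ₂.Contains Q ψ
  | .or φ₁ φ₂ => φ₁.Contains Q ψ ∨ φ₂.Contains Q ψ
  | .quant Q' ψ' => (Q' = Q ∧ ψ' = ψ) ∨ ψ'.ContainsQuant Q ψ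
/-- The state formula `Q ψ` occurs in the path formula `χ`. -/
def PathFormula.ContainsQuant {A : Type u} (χ : PathFormula A) (Q : Quant)
    (ψ : PathFormula A) : Prop :=
  match χ with
  | .state φ => φ.Contains Q ψ
  | .and χ₁ χ₂ => χ₁.ContainsQuant Q ψ ∨ χ₂.ContainsQuant Q ψ
  | .or χ₁ χ₂ => χ₁.ContainsQuant Q ψ ∨ χ₂.ContainsQuant Q ψ
  | .next χ₁ => χ₁.ContainsQuant Q ψ
  | .glob χ₁ => χ₁.ContainsQuant Q ψ
  | .untl χ₁ χ₂ => χ₁.ContainsQuant Q ψ ∨ χ₂.ContainsQuant Q ψ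
end

open Classical in
mutual
/-- Replace every occurrence of the state formula `Q ψ` in `φ` by the state formula `γ`. -/
noncomputable def StateFormula.replace {A : Type u} (φ : StateFormula A) (Q : Quant)
    (ψ : PathFormula A) (γ : StateFormula A) : StateFormula A :=
  match φ with
  | .asrt c => .asrt c
  | .and φ₁ φ₂ => .and (φ₁.replace Q ψ γ) (φ₂.replace Q ψ γ)
  | .or φ₁ φ₂ => .or (φ₁.replace Q ψ γ) (φ₂.replace Q ψ γ)
  | .quant Q' ψ' => if Q' = Q ∧ ψ' = ψ then γ else .quant Q' (ψ'.replaceQuant Q ψ γ)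
/-- Replace every occurrence of the state formula `Q ψ` in `χ` by the state formula `γ`. -/
noncomputable def PathFormula.replaceQuant {A : Type u} (χ : PathFormula A) (Q : Quant)
    (ψ : PathFormula A) (γ : StateFormula A) : PathFormula A :=
  match χ with
  | .state φ => .state (φ.replace Q ψ γ)
  | .and χ₁ χ₂ => .and (χ₁.replaceQuant Q ψ γ) (χ₂.replaceQuant Q ψ γ)
  | .or χ₁ χ₂ => .or (χ₁.replaceQuant Q ψ γ) (χ₂.replaceQuant Q ψ γ)
  | .next χ₁ => .next (χ₁.replaceQuant Q ψ γ)
  | .glob χ₁ => .glob (χ₁.replaceQuant Q ψ γ)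
  | .untl χ₁ χ₂ => .untl (χ₁.replaceQuant Q ψ γ) (χ₂.replaceQuant Q ψ γ)
end

/-- The path formula `old` occurs in `ψ`, not in the scope of a path quantifier (there is none in
the formulas to which this is applied). -/
def PathFormula.Contains {A : Type u} (ψ old : PathFormula A) : Prop :=
  match ψ with
  | .state φ => .state φ = old
  | .and ψ₁ ψ₂ => .and ψ₁ ψ₂ = old ∨ ψ₁.Contains old ∨ ψ₂.Contains old
  | .or ψ₁ ψ₂ => .or ψ₁ ψ₂ = old ∨ ψ₁.Contains old ∨ ψ₂.Contains old
  | .next ψ₁ => .next ψ₁ = old ∨ ψ₁.Contains old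
  | .glob ψ₁ => .glob ψ₁ = old ∨ ψ₁.Contains old
  | .untl ψ₁ ψ₂ => .untl ψ₁ ψ₂ = old ∨ ψ₁.Contains old ∨ ψ₂.Contains old

open Classical in
/-- Replace every occurrence in `ψ` of the path formula `old`, not in the scope of a path
quantifier, by `new`. -/
noncomputable def PathFormula.replace {A : Type u} (ψ old new : PathFormula A) : PathFormula A :=
  match ψ with
  | .state φ => if .state φ = old then new else .state φ
  | .and ψ₁ ψ₂ =>
      if .and ψ₁ ψ₂ = old then new else .and (ψ₁.replace old new) (ψ₂.replace old new)
  | .or ψ₁ ψ₂ =>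
      if .or ψ₁ ψ₂ = old then new else .or (ψ₁.replace old new) (ψ₂.replace old new)
  | .next ψ₁ => if .next ψ₁ = old then new else .next (ψ₁.replace old new)
  | .glob ψ₁ => if .glob ψ₁ = old then new else .glob (ψ₁.replace old new)
  | .untl ψ₁ ψ₂ =>
      if .untl ψ₁ ψ₂ = old then new else .untl (ψ₁.replace old new) (ψ₂.replace old new)

/-! ### Constraints with uninterpreted predicates, and Existential Horn Clauses -/

/-- Valuations of the program variables together with `n` added boolean variables. -/
abbrev State (S : Type u) : ℕ → Type u
  | 0 => S
  | n + 1 => State S n × Bool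

/-- `Fml S n k`: constraints over `k` copies `v_0, …, v_{k-1}` of the tuple consisting of the
program variables and `n` added boolean variables, in which uninterpreted predicates may occur.
* `atom a`: a constraint of the background theory;
* `weaken φ`: `φ`, regarded as a constraint over one more boolean variable;
* `bvar i`: the last added boolean variable of the `i`-th copy;
* `pred a P f`: the uninterpreted predicate `P`, of arity `a` times the size of the tuple,
  applied to the copies `v_{f 0}, …, v_{f (a-1)}`;
* `subst f φ`: the constraint `φ (v_{f 0}, …, v_{f (a-1)})`;
* `conj f`: the finite conjunction of the `f i`;
* `ex φ`: existential quantification over one further copy of the tuple, which comes last;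
* `exBool φ`: existential quantification over the last added boolean variable. -/
inductive Fml (S : Type u) : ℕ → ℕ → Type u where
  | atom {k : ℕ} (a : (Fin k → S) → Prop) : Fml S 0 k
  | weaken {n k : ℕ} (φ : Fml S n k) : Fml S (n + 1) k
  | bvar {n k : ℕ} (i : Fin k) : Fml S (n + 1) k
  | pred {n k : ℕ} (a : ℕ) (P : ℕ) (f : Fin a → Fin k) : Fml S n k
  | subst {n k a : ℕ} (f : Fin a → Fin k) (φ : Fml S n a) : Fml S n k
  | not {n k : ℕ} (φ : Fml S n k) : Fml S n k
  | and {n k : ℕ} (φ₁ φ₂ : Fml S n k) : Fml S n k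
  | or {n k : ℕ} (φ₁ φ₂ : Fml S n k) : Fml S n k
  | iff {n k : ℕ} (φ₁ φ₂ : Fml S n k) : Fml S n k
  | conj {n k m : ℕ} (f : Fin m → Fml S n k) : Fml S n k
  | ex {n k : ℕ} (φ : Fml S n (k + 1)) : Fml S n k
  | exBool {n k : ℕ} (φ : Fml S (n + 1) k) : Fml S n k

/-- An interpretation of the uninterpreted predicates: `I n a P` is the relation that interprets
the predicate named `P` on `a` tuples of program variables and `n` boolean variables. -/
def Interp (S : Type u) : Type u :=
  (n a : ℕ) → ℕ → (Fin a → State S n) → Prop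

/-- Truth of a constraint under an interpretation and a valuation of the copies. -/
def Fml.Holds {S : Type u} (I : Interp S) :
    {n k : ℕ} → Fml S n k → (Fin k → State S n) → Prop
  | _, _, .atom a, v => a v
  | _, _, .weaken φ, v => φ.Holds I (fun i => (v i).1)
  | _, _, .bvar i, v => (v i).2 = true
  | _, _, .pred a P f, v => I _ a P (fun i => v (f i))
  | _, _, .subst f φ, v => φ.Holds I (fun i => v (f i))
  | _, _, .not φ, v => ¬ φ.Holds I v
  | _, _, .and φ₁ φ₂, v => φ₁.Holds I v ∧ φ₂.Holds I v
  | _, _, .or φ₁ φ₂, v => φ₁.Holds I v ∨ φ₂.Holds I v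
  | _, _, .iff φ₁ φ₂, v => φ₁.Holds I v ↔ φ₂.Holds I v
  | _, _, .conj f, v => ∀ i, (f i).Holds I v
  | n, k, .ex φ, v =>
      ∃ s : State S n, φ.Holds I (Fin.snoc (α := fun _ : Fin (k + 1) => State S n) v s)
  | _, k, .exBool φ, v => ∃ b : Fin k → Bool, φ.Holds I (fun i => (v i, b i))

/-- Assertions: constraints over a single copy of the variables. -/
abbrev Asrt (S : Type u) (n : ℕ) : Type u := Fml S n 1

/-- `c (v_i)`. -/
def Fml.at {S : Type u} {n k : ℕ} (c : Asrt S n) (i : Fin k) : Fml S n k :=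
  .subst (fun _ => i) c

/-- `P (v_i)` for an uninterpreted predicate `P` over one copy of the variables. -/
def Fml.pred₁ {S : Type u} {n k : ℕ} (P : ℕ) (i : Fin k) : Fml S n k :=
  .pred 1 P (fun _ => i)

/-- `R (v_i, v_j)` for an uninterpreted predicate `R` over two copies of the variables. -/
def Fml.pred₂ {S : Type u} {n k : ℕ} (R : ℕ) (i j : Fin k) : Fml S n k :=
  .pred 2 R ![i, j]

/-- Existential Horn Clauses: universally closed implications `body → head`, and clauses `dwf (R)`
for an uninterpreted predicate `R` over two copies of the variables. -/
inductive Clause (S : Type u) : Type u where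
  | imp {n k : ℕ} (body head : Fml S n k)
  | dwf (n : ℕ) (R : ℕ)

/-- `r` is disjunctively well-founded: it is contained in a finite union of relations, each of
which admits no infinite chain `x₀ R x₁ R x₂ R …`. -/
def DisjWellFounded {X : Type u} (r : X → X → Prop) : Prop :=
  ∃ (m : ℕ) (R : Fin m → X → X → Prop),
    (∀ i, WellFounded (fun y x => R i x y)) ∧ ∀ x y, r x y → ∃ i, R i x y

/-- The clause is true under the interpretation `I`. -/
def Clause.Holds {S : Type u} (I : Interp S) : Clause S → Prop
  | .imp (n := n) (k := k) body head =>
      ∀ v : Fin k → State S n, body.Holds I v → head.Holds I v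
  | .dwf n R => DisjWellFounded (fun x y : State S n => I n 2 R ![x, y])

/-- A set of clauses is satisfiable if one interpretation makes all of them true. -/
def Satisfiable {S : Type u} (C : Set (Clause S)) : Prop :=
  ∃ I : Interp S, ∀ c ∈ C, c.Holds I

/-! ### The translation -/

/-- A program over the program variables and `n` added boolean variables, in whose description
uninterpreted predicates may occur. -/
structure Prog (S : Type u) (n : ℕ) where
  init : Asrt S n
  next : Fml S n 2
  fair : List (Asrt S n)

/-- A fair transition system, as a program without added variables or uninterpreted predicates. -/
def FTS.toProg {S : Type u} (D : FTS S) : Prog S 0 where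
  init := .atom (fun v => D.init (v 0))
  next := .atom (fun v => D.next (v 0) (v 1))
  fair := D.fair.map (fun J => .atom (fun v => J (v 0)))

/-- A CTL* formula without uninterpreted predicates, as a formula over constraints. -/
def StateFormula.embed {S : Type u} (φ : StateFormula (S → Prop)) : StateFormula (Asrt S 0) :=
  φ.map (fun c => .atom (fun v => c (v 0)))

mutual
/-- The assertion that a boolean combination of assertions is; `none` if the formula contains a
path quantifier. -/
def StateFormula.assertion? {S : Type u} {n : ℕ} : StateFormula (Asrt S n) → Option (Asrt S n)
  | .asrt c => some c
  | .and φ₁ φ₂ => Option.map₂ Fml.and φ₁.assertion? φ₂.assertion?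
  | .or φ₁ φ₂ => Option.map₂ Fml.or φ₁.assertion? φ₂.assertion?
  | .quant _ _ => none
/-- The assertion that a boolean combination of assertions is; `none` if the formula contains a
path quantifier or a temporal operator. -/
def PathFormula.assertion? {S : Type u} {n : ℕ} : PathFormula (Asrt S n) → Option (Asrt S n)
  | .state φ => φ.assertion?
  | .and ψ₁ ψ₂ => Option.map₂ Fml.and ψ₁.assertion? ψ₂.assertion?
  | .or ψ₁ ψ₂ => Option.map₂ Fml.or ψ₁.assertion? ψ₂.assertion?
  | .next _ => none
  | .glob _ => none
  | .untl _ _ => none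
end

/-- The path formula `ψ (x)` over one more boolean variable `x`, obtained from `ψ` by replacing
every occurrence of `old` by `x`. -/
noncomputable def PathFormula.elim {S : Type u} {n : ℕ} (ψ old : PathFormula (Asrt S n)) :
    PathFormula (Asrt S (n + 1)) :=
  (ψ.map Fml.weaken).replace (old.map Fml.weaken) (.state (.asrt (.bvar 0)))

/-- `(v ∪ {x}, init (v), next (v, v') ∧ (x = e), J)`. -/
def Prog.extend {S : Type u} {n : ℕ} (D : Prog S n) (e : Fml S (n + 1) 2) : Prog S (n + 1) where
  init := .weaken D.init
  next := .and (.weaken D.next) (.iff (.bvar 0) e)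
  fair := D.fair.map .weaken

/-- Replace the initial condition by an uninterpreted predicate. -/
def Prog.withInit {S : Type u} {n : ℕ} (D : Prog S n) (aux : ℕ) : Prog S n :=
  { D with init := .pred₁ aux 0 }

/-- Add a fairness condition. -/
def Prog.addFair {S : Type u} {n : ℕ} (D : Prog S n) (J : Asrt S n) : Prog S n :=
  { D with fair := D.fair ++ [J] }

/-- Remove all fairness conditions. -/
def Prog.dropFair {S : Type u} {n : ℕ} (D : Prog S n) : Prog S n :=
  { D with fair := [] }

/-- The program for the elimination of `X c`: add `x = c (v')` to `next`. -/
def Prog.extX {S : Type u} {n : ℕ} (D : Prog S n) (c : Asrt S n) : Prog S (n + 1) :=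
  D.extend (.weaken (c.at 1))

/-- The program for the elimination of `G c`: add `x = (c (v) ∧ x')` to `next`, and the fairness
condition `x ∨ ¬ c (v)`. -/
def Prog.extG {S : Type u} {n : ℕ} (D : Prog S n) (c : Asrt S n) : Prog S (n + 1) :=
  (D.extend (.and (.weaken (c.at 0)) (.bvar 1))).addFair (.or (.bvar 0) (.not (.weaken c)))

/-- The program for the elimination of `c₁ U c₂`: add `x = (c₂ (v) ∨ (c₁ (v) ∧ x'))` to `next`,
and the fairness condition `¬ x ∨ c₂ (v)`. -/
def Prog.extU {S : Type u} {n : ℕ} (D : Prog S n) (c₁ c₂ : Asrt S n) : Prog S (n + 1) :=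
  (D.extend (.or (.weaken (c₂.at 0)) (.and (.weaken (c₁.at 0)) (.bvar 1)))).addFair
    (.or (.not (.bvar 0)) (.weaken c₂))

/-- The clause `init (v) → ∃ x, aux (v, x)`. -/
def auxClause {S : Type u} {n : ℕ} (D : Prog S n) (aux : ℕ) : Clause S :=
  .imp D.init (.exBool (.pred₁ aux 0))

/-- The clauses for `A_f c` that do not depend on whether there are fairness conditions:
`init (v) ∧ ¬ c (v) → p (v)`, `next (v, v') ∧ p (v) → p (v')`, `dwf (r)`,
`next (v, v') → t (v, v')`, `t (v, v') ∧ next (v', v'') → t (v, v'')`. -/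
def clausesAf {S : Type u} {n : ℕ} (D : Prog S n) (c : Asrt S n) (p r t : ℕ) :
    Set (Clause S) :=
  {.imp (.and D.init (.not c)) (.pred₁ p 0),
   .imp (.and D.next (.pred₁ p 0)) (.pred₁ p 1),
   .dwf n r,
   .imp D.next (.pred₂ t 0 1),
   .imp (k := 3) (.and (.pred₂ t 0 1) (.subst ![1, 2] D.next)) (.pred₂ t 0 2)}

/-- The clause `p (v) ∧ t (v, v') → r (v, v')`. -/
def clauseAfNoFair (S : Type u) (n : ℕ) (p r t : ℕ) : Clause S :=
  .imp (n := n) (k := 2) (.and (.pred₁ p 0) (.pred₂ t 0 1)) (.pred₂ r 0 1)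

/-- The clause `p (v_0) ∧ ⋀_{i=1}^{|J|} (t (v_{i-1}, v_i) ∧ J_i (v_i)) → r (v_0, v_{|J|})`. -/
def clauseAfFair {S : Type u} {n : ℕ} (D : Prog S n) (p r t : ℕ) : Clause S :=
  .imp (n := n) (k := D.fair.length + 1)
    (.and (.pred₁ p 0)
      (.conj fun i : Fin D.fair.length =>
        .and (.pred₂ t i.castSucc i.succ) ((D.fair.get i).at i.succ)))
    (.pred₂ r 0 (Fin.last _))

/-- The clauses `init (v) → c (v) ∧ q (v)` and `q (v) → ∃ v', next (v, v') ∧ q (v')`. -/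
def clausesEfNoFair {S : Type u} {n : ℕ} (D : Prog S n) (c : Asrt S n) (q : ℕ) :
    Set (Clause S) :=
  {.imp D.init (.and c (.pred₁ q 0)),
   .imp (k := 1) (.pred₁ q 0) (.ex (.and D.next (.pred₁ q 1)))}

/-- For `J ≠ ∅`: the clause `init (v) → c (v) ∧ q_1 (v)` and, for each `i ≤ |J|`, the clauses
`q_i (v) → ∃ v', next (v, v') ∧ ((J_i (v) ∧ q_{(i % |J|) + 1} (v')) ∨ (r_i (v, v') ∧ q_i (v')))`,
`dwf (r_i)` and `r_i (v, v') ∧ r_i (v', v'') → r_i (v, v'')`.  Here indices start at `0`. -/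
def clausesEfFair {S : Type u} {n : ℕ} (D : Prog S n) (hJ : 0 < D.fair.length) (c : Asrt S n)
    (q r : Fin D.fair.length → ℕ) : Set (Clause S) :=
  {.imp D.init (.and c (.pred₁ (q ⟨0, hJ⟩) 0))} ∪
  ⋃ i : Fin D.fair.length,
    {.imp (k := 1) (.pred₁ (q i) 0)
       (.ex (.and D.next
         (.or (.and ((D.fair.get i).at 0)
                (.pred₁ (q ⟨(i.val + 1) % D.fair.length, Nat.mod_lt _ hJ⟩) 1))
              (.and (.pred₂ (r i) 0 1) (.pred₁ (q i) 1))))),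
     .dwf n (r i),
     .imp (n := n) (k := 3) (.and (.pred₂ (r i) 0 1) (.pred₂ (r i) 1 2)) (.pred₂ (r i) 0 2)}

/-- `Trans U D φ C U'`: the translation system can produce the set of clauses `C` for the
verification problem `(D, φ)`, where `U` is the set of names of uninterpreted predicates already in
use before, and `U'` the one after the translation.  A predicate is fresh if its name is not in the
current set. -/
inductive Trans {S : Type u} : {n : ℕ} → Set ℕ → Prog S n → StateFormula (Asrt S n) →
    Set (Clause S) → Set ℕ → Prop
  /-- Replacement of a basic state subformula `Q ψ`. -/
  | rule1 {n : ℕ} {U U₁ U₂ : Set ℕ} {D : Prog S n} {φ : StateFormula (Asrt S n)} {Q : Quant}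
      {ψ : PathFormula (Asrt S n)} {aux : ℕ} {C₁ C₂ : Set (Clause S)} :
      ψ.QuantFree → φ.Contains Q ψ → aux ∉ U →
      Trans (insert aux U) (D.withInit aux) (.quant Q ψ) C₁ U₁ →
      Trans U₁ D (φ.replace Q ψ (.asrt (.pred₁ aux 0))) C₂ U₂ →
      Trans U D φ (C₁ ∪ C₂) U₂
  /-- From `A ψ` to `A_f ψ`. -/
  | rule2A {n : ℕ} {U U' : Set ℕ} {D : Prog S n} {ψ : PathFormula (Asrt S n)}
      {C : Set (Clause S)} :
      ψ.QuantFree → Trans U D.dropFair (.quant .Af ψ) C U' → Trans U D (.quant .A ψ) C U'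
  /-- From `E ψ` to `E_f ψ`. -/
  | rule2E {n : ℕ} {U U' : Set ℕ} {D : Prog S n} {ψ : PathFormula (Asrt S n)}
      {C : Set (Clause S)} :
      ψ.QuantFree → Trans U D.dropFair (.quant .Ef ψ) C U' → Trans U D (.quant .E ψ) C U'
  /-- Elimination of `X c` under `A_f`. -/
  | rule3A {n : ℕ} {U U' : Set ℕ} {D : Prog S n} {ψ ξ : PathFormula (Asrt S n)} {c : Asrt S n}
      {C : Set (Clause S)} :
      ψ.QuantFree → ξ.assertion? = some c → ψ.Contains (.next ξ) →
      Trans U (D.extX c) (.quant .Af (ψ.elim (.next ξ))) C U' →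
      Trans U D (.quant .Af ψ) C U'
  /-- Elimination of `X c` under `E_f`. -/
  | rule3E {n : ℕ} {U U' : Set ℕ} {D : Prog S n} {ψ ξ : PathFormula (Asrt S n)} {c : Asrt S n}
      {aux : ℕ} {C : Set (Clause S)} :
      ψ.QuantFree → ξ.assertion? = some c → ψ.Contains (.next ξ) → aux ∉ U →
      Trans (insert aux U) ((D.extX c).withInit aux)
        (.quant .Ef (ψ.elim (.next ξ))) C U' →
      Trans U D (.quant .Ef ψ) ({auxClause D aux} ∪ C) U'
  /-- Elimination of `G c` under `A_f`. -/
  | rule4A {n : ℕ} {U U' : Set ℕ} {D : Prog S n} {ψ ξ : PathFormula (Asrt S n)} {c : Asrt S n}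
      {C : Set (Clause S)} :
      ψ.QuantFree → ξ.assertion? = some c → ψ.Contains (.glob ξ) →
      Trans U (D.extG c) (.quant .Af (ψ.elim (.glob ξ))) C U' →
      Trans U D (.quant .Af ψ) C U'
  /-- Elimination of `G c` under `E_f`. -/
  | rule4E {n : ℕ} {U U' : Set ℕ} {D : Prog S n} {ψ ξ : PathFormula (Asrt S n)} {c : Asrt S n}
      {aux : ℕ} {C : Set (Clause S)} :
      ψ.QuantFree → ξ.assertion? = some c → ψ.Contains (.glob ξ) → aux ∉ U →
      Trans (insert aux U) ((D.extG c).withInit aux)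
        (.quant .Ef (ψ.elim (.glob ξ))) C U' →
      Trans U D (.quant .Ef ψ) ({auxClause D aux} ∪ C) U'
  /-- Elimination of `c₁ U c₂` under `A_f`. -/
  | rule5A {n : ℕ} {U U' : Set ℕ} {D : Prog S n} {ψ ξ₁ ξ₂ : PathFormula (Asrt S n)}
      {c₁ c₂ : Asrt S n} {C : Set (Clause S)} :
      ψ.QuantFree → ξ₁.assertion? = some c₁ → ξ₂.assertion? = some c₂ →
      ψ.Contains (.untl ξ₁ ξ₂) →
      Trans U (D.extU c₁ c₂) (.quant .Af (ψ.elim (.untl ξ₁ ξ₂))) C U' →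
      Trans U D (.quant .Af ψ) C U'
  /-- Elimination of `c₁ U c₂` under `E_f`. -/
  | rule5E {n : ℕ} {U U' : Set ℕ} {D : Prog S n} {ψ ξ₁ ξ₂ : PathFormula (Asrt S n)}
      {c₁ c₂ : Asrt S n} {aux : ℕ} {C : Set (Clause S)} :
      ψ.QuantFree → ξ₁.assertion? = some c₁ → ξ₂.assertion? = some c₂ →
      ψ.Contains (.untl ξ₁ ξ₂) → aux ∉ U →
      Trans (insert aux U) ((D.extU c₁ c₂).withInit aux)
        (.quant .Ef (ψ.elim (.untl ξ₁ ξ₂))) C U' →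
      Trans U D (.quant .Ef ψ) ({auxClause D aux} ∪ C) U'
  /-- `A_f c`, with fairness conditions. -/
  | rule6Fair {n : ℕ} {U : Set ℕ} {D : Prog S n} {ψ : PathFormula (Asrt S n)} {c : Asrt S n}
      {p r t : ℕ} :
      ψ.assertion? = some c → D.fair ≠ [] →
      p ∉ U → r ∉ U → t ∉ U → p ≠ r → p ≠ t → r ≠ t →
      Trans U D (.quant .Af ψ) (clausesAf D c p r t ∪ {clauseAfFair D p r t}) (U ∪ {p, r, t})
  /-- `A_f c`, without fairness conditions. -/
  | rule6NoFair {n : ℕ} {U : Set ℕ} {D : Prog S n} {ψ : PathFormula (Asrt S n)} {c : Asrt S n}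
      {p r t : ℕ} :
      ψ.assertion? = some c → D.fair = [] →
      p ∉ U → r ∉ U → t ∉ U → p ≠ r → p ≠ t → r ≠ t →
      Trans U D (.quant .Af ψ) (clausesAf D c p r t ∪ {clauseAfNoFair S n p r t})
        (U ∪ {p, r, t})
  /-- `E_f c`, with fairness conditions. -/
  | rule7Fair {n : ℕ} {U : Set ℕ} {D : Prog S n} {ψ : PathFormula (Asrt S n)} {c : Asrt S n}
      {q r : Fin D.fair.length → ℕ} (hJ : 0 < D.fair.length) :
      ψ.assertion? = some c → Function.Injective q → Function.Injective r →
      (∀ i, q i ∉ U) → (∀ i, r i ∉ U) → (∀ i j, q i ≠ r j) →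
      Trans U D (.quant .Ef ψ) (clausesEfFair D hJ c q r) (U ∪ Set.range q ∪ Set.range r)
  /-- `E_f c`, without fairness conditions. -/
  | rule7NoFair {n : ℕ} {U : Set ℕ} {D : Prog S n} {ψ : PathFormula (Asrt S n)} {c : Asrt S n}
      {q : ℕ} :
      ψ.assertion? = some c → D.fair = [] → q ∉ U →
      Trans U D (.quant .Ef ψ) (clausesEfNoFair D c q) (insert q U)
  /-- Assertions. -/
  | rule8 {n : ℕ} {U : Set ℕ} {D : Prog S n} {φ : StateFormula (Asrt S n)} {c : Asrt S n} :
      φ.assertion? = some c → Trans U D φ {.imp D.init c} U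

/-- `C` is one of the sets `Clauses (v, init, next, J, φ)` that the translation can produce. -/
def IsClauses {S : Type u} (D : FTS S) (φ : StateFormula (S → Prop)) (C : Set (Clause S)) :
    Prop :=
  ∃ U : Set ℕ, Trans ∅ D.toProg φ.embed C U

end EHC

/-!
Soundness of the translation into Existential Horn Clauses.

Fix an interpretation `I` of the uninterpreted predicates that makes all produced clauses true.
Under `I` every program over constraints is an ordinary fair transition system (`Prog.sem`) and
every formula over constraints an ordinary CTL* formula.  Induction on the derivation
(`Trans.sound`) shows that each program satisfies its formula under this reading, the same `I`
serving all verification problems of the derivation.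

* Replacing a subformula by a stronger one strengthens the whole formula, because negation occurs
  only inside assertions (`StateFormula.sat_of_sat_replace`, `PathFormula.sat_of_sat_replace`).
  This settles the replacement of `Q ψ` by `aux`, and reduces the elimination of `X c`, `G c` and
  `c₁ U c₂` to the claim that the new boolean variable implies the temporal formula it replaces
  (`PathFormula.sat_of_sat_elim`).  Under `A_f`, a fair path is extended by the truth value of the
  temporal formula (`valid_Af_of_elim`); under `E_f`, the equation for `x` and the added fairness
  condition give the implication along every fair path of the extended program
  (`valid_Ef_of_elim`).
* A disjunctively well-founded relation cannot hold between all pairs `x i`, `x j`, `i < j`, of an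
  infinite sequence, by Ramsey's theorem (`DisjWellFounded.not_forall_lt`).  For `A_f c` it
  refutes a fair path from an initial state violating `c` (`not_forall_fair_of_disjWellFounded`);
  for `E_f c` it shows that following the predicates `q_i` every fairness condition is eventually
  reached (`exists_fair_path_of_disjWellFounded`).
-/

namespace EHC

universe u

/-! ### Disjunctive well-foundedness -/

theorem DisjWellFounded.not_forall_lt {X : Type u} {r : X → X → Prop} (hr : DisjWellFounded r)
    (x : ℕ → X) : ¬ ∀ i j, i < j → r (x i) (x j) := by
  obtain ⟨m, R, hwf, hR⟩ := hr
  have key : ∀ (m : ℕ) (R : Fin m → X → X → Prop),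
      (∀ i, WellFounded (fun y x => R i x y)) → ∀ x : ℕ → X,
      ¬ ∀ i j, i < j → ∃ l, R l (x i) (x j) := by
    intro m
    induction m with
    | zero =>
      intro R _ x h
      obtain ⟨l, -⟩ := h 0 1 Nat.zero_lt_one
      exact l.elim0
    | succ m ih =>
      intro R hwf x h
      -- Ramsey: on a subsequence, `R 0` links consecutive elements, or it links no pair at all.
      obtain ⟨g, hg | hg⟩ := exists_increasing_or_nonincreasing_subseq' (R 0) x
      · obtain ⟨a, ⟨n, rfl⟩, hmin⟩ :=
          (hwf 0).has_min (Set.range fun n => x (g n)) ⟨_, 0, rfl⟩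
        exact hmin _ ⟨n + 1, rfl⟩ (hg n)
      · refine ih (fun i => R i.succ) (fun i => hwf _) (fun n => x (g n)) fun i j hij => ?_
        obtain ⟨l, hl⟩ := h (g i) (g j) (g.strictMono hij)
        induction l using Fin.cases with
        | zero => exact absurd hl (hg i j hij)
        | succ l => exact ⟨l, hl⟩
  exact fun h => key m R hwf x fun i j hij => hR _ _ (h i j hij)

/-- A sequence satisfying `p` everywhere cannot be fair if `r` links any two elements of it between
which the fairness conditions have been met in turn. -/
theorem not_forall_fair_of_disjWellFounded {X : Type u} {m : ℕ} (hm : 0 < m)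
    {J : Fin m → X → Prop} {p : X → Prop} {t r : X → X → Prop} (hdwf : DisjWellFounded r)
    (hr : ∀ v : Fin (m + 1) → X, p (v 0) →
      (∀ i : Fin m, t (v i.castSucc) (v i.succ) ∧ J i (v i.succ)) → r (v 0) (v (Fin.last m)))
    {π : ℕ → X} (hp : ∀ i, p (π i)) (ht : ∀ i j, i < j → t (π i) (π j)) :
    ¬ ∀ i N, ∃ j, N ≤ j ∧ J i (π j) := by
  intro hJ
  choose F hF hFJ using hJ
  -- Times `a 0 < a 1 < …` at which the fairness conditions hold cyclically.
  let a : ℕ → ℕ := fun n => Nat.rec 0 (fun n b => F ⟨n % m, Nat.mod_lt n hm⟩ (b + 1)) n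
  have ha : StrictMono a := strictMono_nat_of_lt_succ fun n => hF _ (a n + 1)
  have haJ : ∀ n, J ⟨n % m, Nat.mod_lt n hm⟩ (π (a (n + 1))) := fun n => hFJ _ (a n + 1)
  refine hdwf.not_forall_lt (fun k => π (a (k * m))) fun k l hkl => ?_
  obtain ⟨l, rfl⟩ : ∃ l', l = l' + 1 := ⟨l - 1, by omega⟩
  have hkl' : k * m ≤ l * m := Nat.mul_le_mul_right m (by omega)
  -- The last round before `a ((l + 1) * m)`; the first link reaches back to `a (k * m)`.
  have h := hr (Fin.cons (π (a (k * m))) fun j => π (a (l * m + j + 1))) (hp _) fun i => by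
    refine ⟨?_, ?_⟩
    · obtain ⟨i, hi⟩ := i
      cases i with
      | zero => exact ht _ _ (ha (show k * m < l * m + 0 + 1 by omega))
      | succ i => exact ht _ _ (ha (show l * m + i + 1 < l * m + (i + 1) + 1 by omega))
    · have h := haJ (l * m + i)
      have hi : (l * m + i) % m = i := by
        rw [Nat.mul_comm, Nat.mul_add_mod, Nat.mod_eq_of_lt i.isLt]
      simpa [hi] using h
  obtain ⟨m, rfl⟩ : ∃ m', m = m' + 1 := ⟨m - 1, by omega⟩
  have hl : l * (m + 1) + m + 1 = (l + 1) * (m + 1) := by ring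
  simpa [← Fin.succ_last, hl] using h

/-- States satisfying `q i` can be continued to a fair path: `q i` is left only by meeting `J i`,
and the well-foundedness of `r i` forces it to be left. -/
theorem exists_fair_path_of_disjWellFounded {X : Type u} {m : ℕ} (hm : 0 < m)
    {next : X → X → Prop} {J q : Fin m → X → Prop} {r : Fin m → X → X → Prop}
    (hstep : ∀ i v, q i v → ∃ v', next v v' ∧
      ((J i v ∧ q ⟨(i.val + 1) % m, Nat.mod_lt _ hm⟩ v') ∨ (r i v v' ∧ q i v')))
    (hdwf : ∀ i, DisjWellFounded (r i))
    (htrans : ∀ i x y z, r i x y → r i y z → r i x z) {i₀ : Fin m} {s : X} (hs : q i₀ s) :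
    ∃ π : ℕ → X, π 0 = s ∧ (∀ n, next (π n) (π (n + 1))) ∧
      ∀ i N, ∃ j, N ≤ j ∧ J i (π j) := by
  have hstep' : ∀ z : {z : Fin m × X // q z.1 z.2}, ∃ z' : {z : Fin m × X // q z.1 z.2},
      next z.1.2 z'.1.2 ∧ ((J z.1.1 z.1.2 ∧ z'.1.1.val = (z.1.1.val + 1) % m) ∨
        (r z.1.1 z.1.2 z'.1.2 ∧ z'.1.1 = z.1.1)) := by
    rintro ⟨⟨i, v⟩, hq⟩
    obtain ⟨v', hn, ⟨hJ, hq'⟩ | ⟨hr, hq'⟩⟩ := hstep i v hq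
    · exact ⟨⟨⟨_, v'⟩, hq'⟩, hn, .inl ⟨hJ, rfl⟩⟩
    · exact ⟨⟨⟨i, v'⟩, hq'⟩, hn, .inr ⟨hr, rfl⟩⟩
  choose f hfn hf using hstep'
  let z : ℕ → {z : Fin m × X // q z.1 z.2} := fun n => Nat.rec ⟨⟨i₀, s⟩, hs⟩ (fun _ => f) n
  have hzn : ∀ n, next (z n).1.2 (z (n + 1)).1.2 := fun n => hfn (z n)
  have hz : ∀ n, (J (z n).1.1 (z n).1.2 ∧ (z (n + 1)).1.1.val = ((z n).1.1.val + 1) % m) ∨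
      (r (z n).1.1 (z n).1.2 (z (n + 1)).1.2 ∧ (z (n + 1)).1.1 = (z n).1.1) := fun n => hf (z n)
  -- The current index is eventually advanced, its fairness condition being met then.
  have hadv : ∀ N, ∃ k, N ≤ k ∧ (z k).1.1 = (z N).1.1 ∧ J (z k).1.1 (z k).1.2 ∧
      (z (k + 1)).1.1.val = ((z k).1.1.val + 1) % m := by
    intro N
    by_contra hcon
    have hidx : ∀ k, (z (N + k)).1.1 = (z N).1.1 ∧
        r (z N).1.1 (z (N + k)).1.2 (z (N + (k + 1))).1.2 := by
      have aux : ∀ k, (z (N + k)).1.1 = (z N).1.1 →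
          r (z N).1.1 (z (N + k)).1.2 (z (N + (k + 1))).1.2 ∧
            (z (N + (k + 1))).1.1 = (z N).1.1 := by
        intro k hk
        rcases hz (N + k) with h | h
        · exact absurd ⟨N + k, by omega, hk, h⟩ hcon
        · rw [hk] at h
          exact h
      have hk : ∀ k, (z (N + k)).1.1 = (z N).1.1 := by
        intro k
        induction k with
        | zero => rfl
        | succ k ih => exact (aux k ih).2
      exact fun k => ⟨hk k, (aux k (hk k)).1⟩
    refine (hdwf (z N).1.1).not_forall_lt (fun k => (z (N + k)).1.2) fun i j hij => ?_
    induction j, hij using Nat.le_induction with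
    | base => exact (hidx i).2
    | succ j _ ih => exact htrans _ _ _ _ ih (hidx j).2
  have hreach : ∀ N d, ∃ k, N ≤ k ∧ (z k).1.1.val = ((z N).1.1.val + d) % m := by
    intro N d
    induction d with
    | zero => exact ⟨N, le_rfl, (Nat.mod_eq_of_lt (z N).1.1.isLt).symm⟩
    | succ d ih =>
      obtain ⟨k, hk, hkd⟩ := ih
      obtain ⟨l, hl, hlk, -, hnext⟩ := hadv k
      refine ⟨l + 1, by omega, ?_⟩
      rw [hnext, hlk, hkd, Nat.mod_add_mod, Nat.add_assoc]
  refine ⟨fun n => (z n).1.2, rfl, hzn, fun i N => ?_⟩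
  obtain ⟨k, hk, hki⟩ := hreach N (m - (z N).1.1.val + i.val)
  have hki' : (z k).1.1 = i := by
    have := (z N).1.1.isLt
    refine Fin.ext (hki.trans ?_)
    rw [show (z N).1.1.val + (m - (z N).1.1.val + i.val) = m + i.val by omega,
      Nat.add_mod_left, Nat.mod_eq_of_lt i.isLt]
  obtain ⟨l, hl, hlk, hJ, -⟩ := hadv k
  rw [hlk, hki'] at hJ
  exact ⟨l, hk.trans hl, hJ⟩

/-! ### Satisfaction under renaming of assertions -/

mutual
theorem StateFormula.map_map {A B C : Type u} (f : A → B) (g : B → C) :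
    ∀ φ : StateFormula A, (φ.map f).map g = φ.map (g ∘ f)
  | .asrt _ => rfl
  | .and φ₁ φ₂ => by
    simp only [StateFormula.map, StateFormula.map_map f g φ₁, StateFormula.map_map f g φ₂]
  | .or φ₁ φ₂ => by
    simp only [StateFormula.map, StateFormula.map_map f g φ₁, StateFormula.map_map f g φ₂]
  | .quant _ ψ => by simp only [StateFormula.map, PathFormula.map_map f g ψ]
theorem PathFormula.map_map {A B C : Type u} (f : A → B) (g : B → C) :
    ∀ ψ : PathFormula A, (ψ.map f).map g = ψ.map (g ∘ f)
  | .state φ => by simp only [PathFormula.map, StateFormula.map_map f g φ]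
  | .and ψ₁ ψ₂ => by
    simp only [PathFormula.map, PathFormula.map_map f g ψ₁, PathFormula.map_map f g ψ₂]
  | .or ψ₁ ψ₂ => by
    simp only [PathFormula.map, PathFormula.map_map f g ψ₁, PathFormula.map_map f g ψ₂]
  | .next ψ => by simp only [PathFormula.map, PathFormula.map_map f g ψ]
  | .glob ψ => by simp only [PathFormula.map, PathFormula.map_map f g ψ]
  | .untl ψ₁ ψ₂ => by
    simp only [PathFormula.map, PathFormula.map_map f g ψ₁, PathFormula.map_map f g ψ₂]
end

mutual
theorem StateFormula.map_id {A : Type u} : ∀ φ : StateFormula A, φ.map id = φ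
  | .asrt _ => rfl
  | .and φ₁ φ₂ => by simp only [StateFormula.map, StateFormula.map_id φ₁, StateFormula.map_id φ₂]
  | .or φ₁ φ₂ => by simp only [StateFormula.map, StateFormula.map_id φ₁, StateFormula.map_id φ₂]
  | .quant _ ψ => by simp only [StateFormula.map, PathFormula.map_id ψ]
theorem PathFormula.map_id {A : Type u} : ∀ ψ : PathFormula A, ψ.map id = ψ
  | .state φ => by simp only [PathFormula.map, StateFormula.map_id φ]
  | .and ψ₁ ψ₂ => by simp only [PathFormula.map, PathFormula.map_id ψ₁, PathFormula.map_id ψ₂]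
  | .or ψ₁ ψ₂ => by simp only [PathFormula.map, PathFormula.map_id ψ₁, PathFormula.map_id ψ₂]
  | .next ψ => by simp only [PathFormula.map, PathFormula.map_id ψ]
  | .glob ψ => by simp only [PathFormula.map, PathFormula.map_id ψ]
  | .untl ψ₁ ψ₂ => by simp only [PathFormula.map, PathFormula.map_id ψ₁, PathFormula.map_id ψ₂]
end

mutual
theorem StateFormula.sat_map_comp {A X Y : Type u} {f : A → Y → Prop} {e : A → X → Prop}
    {g : Y → X} (h : ∀ a y, f a y ↔ e a (g y)) (D : FTS X) (D' : FTS Y) :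
    ∀ φ : StateFormula A, φ.QuantFree → ∀ s, (φ.map f).Sat D' s ↔ (φ.map e).Sat D (g s)
  | .asrt c, _, s => h c s
  | .and φ₁ φ₂, hφ, s => and_congr (StateFormula.sat_map_comp h D D' φ₁ hφ.1 s)
      (StateFormula.sat_map_comp h D D' φ₂ hφ.2 s)
  | .or φ₁ φ₂, hφ, s => or_congr (StateFormula.sat_map_comp h D D' φ₁ hφ.1 s)
      (StateFormula.sat_map_comp h D D' φ₂ hφ.2 s)
  | .quant _ _, hφ, _ => hφ.elim
/-- Satisfaction of a formula without path quantifiers depends on the path only, and on it only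
through the values of the assertions. -/
theorem PathFormula.sat_map_comp {A X Y : Type u} {f : A → Y → Prop} {e : A → X → Prop}
    {g : Y → X} (h : ∀ a y, f a y ↔ e a (g y)) (D : FTS X) (D' : FTS Y) :
    ∀ ψ : PathFormula A, ψ.QuantFree → ∀ σ : ℕ → Y,
      (ψ.map f).Sat D' σ ↔ (ψ.map e).Sat D (fun i => g (σ i))
  | .state φ, hψ, σ => StateFormula.sat_map_comp h D D' φ hψ (σ 0)
  | .and ψ₁ ψ₂, hψ, σ => and_congr (PathFormula.sat_map_comp h D D' ψ₁ hψ.1 σ)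
      (PathFormula.sat_map_comp h D D' ψ₂ hψ.2 σ)
  | .or ψ₁ ψ₂, hψ, σ => or_congr (PathFormula.sat_map_comp h D D' ψ₁ hψ.1 σ)
      (PathFormula.sat_map_comp h D D' ψ₂ hψ.2 σ)
  | .next ψ, hψ, _ => PathFormula.sat_map_comp h D D' ψ hψ _
  | .glob ψ, hψ, _ => forall_congr' fun _ => PathFormula.sat_map_comp h D D' ψ hψ _
  | .untl ψ₁ ψ₂, hψ, _ => exists_congr fun _ =>
      and_congr (PathFormula.sat_map_comp h D D' ψ₂ hψ.2 _)
        (forall_congr' fun _ => imp_congr_right fun _ =>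
          PathFormula.sat_map_comp h D D' ψ₁ hψ.1 _)
end

/-! ### Monotonicity of replacement -/

mutual
/-- Formulas in negation normal form are monotone: replacing `Q ψ` by a formula that implies it
yields a formula that implies the original one. -/
theorem StateFormula.sat_of_sat_replace {A X : Type u} {e : A → X → Prop} {D : FTS X} {Q : Quant}
    {ψ : PathFormula A} {γ : StateFormula A}
    (h : ∀ s, (γ.map e).Sat D s → ((StateFormula.quant Q ψ).map e).Sat D s) :
    ∀ (φ : StateFormula A) (s : X), ((φ.replace Q ψ γ).map e).Sat D s → (φ.map e).Sat D s
  | .asrt _, _, hs => hs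
  | .and φ₁ φ₂, s, hs => by
    exact ⟨StateFormula.sat_of_sat_replace h φ₁ s hs.1,
      StateFormula.sat_of_sat_replace h φ₂ s hs.2⟩
  | .or φ₁ φ₂, s, hs => by
    exact Or.imp (StateFormula.sat_of_sat_replace h φ₁ s)
      (StateFormula.sat_of_sat_replace h φ₂ s) hs
  | .quant Q' ψ', s, hs => by
    rw [StateFormula.replace] at hs
    split_ifs at hs with heq
    · obtain ⟨rfl, rfl⟩ := heq
      exact h s hs
    · have ih := PathFormula.sat_of_sat_replaceQuant h ψ'
      cases Q' with
      | A => exact fun π hπ h0 => ih π (hs π hπ h0)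
      | E =>
        obtain ⟨π, hπ, h0, hψ⟩ := hs
        exact ⟨π, hπ, h0, ih π hψ⟩
      | Af => exact fun π hπ h0 => ih π (hs π hπ h0)
      | Ef =>
        obtain ⟨π, hπ, h0, hψ⟩ := hs
        exact ⟨π, hπ, h0, ih π hψ⟩
theorem PathFormula.sat_of_sat_replaceQuant {A X : Type u} {e : A → X → Prop} {D : FTS X}
    {Q : Quant} {ψ : PathFormula A} {γ : StateFormula A}
    (h : ∀ s, (γ.map e).Sat D s → ((StateFormula.quant Q ψ).map e).Sat D s) :
    ∀ (χ : PathFormula A) (π : ℕ → X),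
      ((χ.replaceQuant Q ψ γ).map e).Sat D π → (χ.map e).Sat D π
  | .state φ, π, hs => StateFormula.sat_of_sat_replace h φ (π 0) hs
  | .and χ₁ χ₂, π, hs => by
    exact ⟨PathFormula.sat_of_sat_replaceQuant h χ₁ π hs.1,
      PathFormula.sat_of_sat_replaceQuant h χ₂ π hs.2⟩
  | .or χ₁ χ₂, π, hs => by
    exact Or.imp (PathFormula.sat_of_sat_replaceQuant h χ₁ π)
      (PathFormula.sat_of_sat_replaceQuant h χ₂ π) hs
  | .next χ, _, hs => PathFormula.sat_of_sat_replaceQuant h χ _ hs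
  | .glob χ, _, hs => fun k => PathFormula.sat_of_sat_replaceQuant h χ _ (hs k)
  | .untl χ₁ χ₂, _, hs => by
    obtain ⟨k, hk, hj⟩ := hs
    exact ⟨k, PathFormula.sat_of_sat_replaceQuant h χ₂ _ hk,
      fun j hjk => PathFormula.sat_of_sat_replaceQuant h χ₁ _ (hj j hjk)⟩
end

/-- Monotonicity for the replacement of path formulas; the implication is needed on the suffixes of
the given path only. -/
theorem PathFormula.sat_of_sat_replace {A X : Type u} {e : A → X → Prop} {D : FTS X}
    {old new : PathFormula A} :
    ∀ (ψ : PathFormula A) (π : ℕ → X),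
      (∀ k, (new.map e).Sat D (fun i => π (i + k)) → (old.map e).Sat D (fun i => π (i + k))) →
      ((ψ.replace old new).map e).Sat D π → (ψ.map e).Sat D π
  | .state φ, π, h, hs => by
    rw [PathFormula.replace] at hs
    split_ifs at hs with heq
    · exact heq ▸ h 0 hs
    · exact hs
  | .and ψ₁ ψ₂, π, h, hs => by
    rw [PathFormula.replace] at hs
    split_ifs at hs with heq
    · exact heq ▸ h 0 hs
    · exact ⟨sat_of_sat_replace ψ₁ π h hs.1, sat_of_sat_replace ψ₂ π h hs.2⟩
  | .or ψ₁ ψ₂, π, h, hs => by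
    rw [PathFormula.replace] at hs
    split_ifs at hs with heq
    · exact heq ▸ h 0 hs
    · exact Or.imp (sat_of_sat_replace ψ₁ π h) (sat_of_sat_replace ψ₂ π h) hs
  | .next ψ, π, h, hs => by
    rw [PathFormula.replace] at hs
    split_ifs at hs with heq
    · exact heq ▸ h 0 hs
    · exact sat_of_sat_replace ψ (fun i => π (i + 1))
        (fun k => by simpa only [Nat.add_assoc] using h (k + 1)) hs
  | .glob ψ, π, h, hs => by
    rw [PathFormula.replace] at hs
    split_ifs at hs with heq
    · exact heq ▸ h 0 hs
    · exact fun l => sat_of_sat_replace ψ (fun i => π (i + l))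
        (fun k => by simpa only [Nat.add_assoc] using h (k + l)) (hs l)
  | .untl ψ₁ ψ₂, π, h, hs => by
    rw [PathFormula.replace] at hs
    split_ifs at hs with heq
    · exact heq ▸ h 0 hs
    · obtain ⟨l, hl, hj⟩ := hs
      exact ⟨l, sat_of_sat_replace ψ₂ (fun i => π (i + l))
          (fun k => by simpa only [Nat.add_assoc] using h (k + l)) hl,
        fun j hjl => sat_of_sat_replace ψ₁ (fun i => π (i + j))
          (fun k => by simpa only [Nat.add_assoc] using h (k + j)) (hj j hjl)⟩

/-! ### Programs and formulas under an interpretation -/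

/-- The set of states that an assertion denotes under an interpretation. -/
def Fml.eval {S : Type u} (I : Interp S) {n : ℕ} (c : Asrt S n) (s : State S n) : Prop :=
  c.Holds I (fun _ => s)

/-- The fair transition system that a program denotes under an interpretation. -/
def Prog.sem {S : Type u} (I : Interp S) {n : ℕ} (D : Prog S n) : FTS (State S n) where
  init := D.init.eval I
  next s s' := D.next.Holds I ![s, s']
  fair := D.fair.map (Fml.eval I)

mutual
theorem StateFormula.sat_of_assertion? {S : Type u} {I : Interp S} {n : ℕ}
    (D : FTS (State S n)) : ∀ {φ : StateFormula (Asrt S n)} {c : Asrt S n},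
      φ.assertion? = some c → ∀ s, (φ.map (Fml.eval I)).Sat D s ↔ c.eval I s
  | .asrt _, _, h, _ => by
    cases h
    exact Iff.rfl
  | .and φ₁ φ₂, _, h, s => by
    obtain ⟨_, _, h₁, h₂, rfl⟩ := Option.map₂_eq_some_iff.1 h
    exact and_congr (StateFormula.sat_of_assertion? D h₁ s)
      (StateFormula.sat_of_assertion? D h₂ s)
  | .or φ₁ φ₂, _, h, s => by
    obtain ⟨_, _, h₁, h₂, rfl⟩ := Option.map₂_eq_some_iff.1 h
    exact or_congr (StateFormula.sat_of_assertion? D h₁ s)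
      (StateFormula.sat_of_assertion? D h₂ s)
  | .quant _ _, _, h, _ => by cases h
theorem PathFormula.sat_of_assertion? {S : Type u} {I : Interp S} {n : ℕ}
    (D : FTS (State S n)) : ∀ {ψ : PathFormula (Asrt S n)} {c : Asrt S n},
      ψ.assertion? = some c → ∀ π, (ψ.map (Fml.eval I)).Sat D π ↔ c.eval I (π 0)
  | .state _, _, h, π => StateFormula.sat_of_assertion? D h (π 0)
  | .and ψ₁ ψ₂, _, h, π => by
    obtain ⟨_, _, h₁, h₂, rfl⟩ := Option.map₂_eq_some_iff.1 h
    exact and_congr (PathFormula.sat_of_assertion? D h₁ π)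
      (PathFormula.sat_of_assertion? D h₂ π)
  | .or ψ₁ ψ₂, _, h, π => by
    obtain ⟨_, _, h₁, h₂, rfl⟩ := Option.map₂_eq_some_iff.1 h
    exact or_congr (PathFormula.sat_of_assertion? D h₁ π)
      (PathFormula.sat_of_assertion? D h₂ π)
  | .next _, _, h, _ => by cases h
  | .glob _, _, h, _ => by cases h
  | .untl _ _, _, h, _ => by cases h
end

theorem Fml.holds_pred₂ {S : Type u} (I : Interp S) {n k : ℕ} (R : ℕ) (i j : Fin k)
    (v : Fin k → State S n) : (Fml.pred₂ R i j).Holds I v ↔ I n 2 R ![v i, v j] := by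
  have : (fun l => v ((![i, j] : Fin 2 → Fin k) l)) = ![v i, v j] := by
    funext l
    fin_cases l <;> rfl
  exact iff_of_eq (congrArg (I n 2 R) this)

theorem Prog.sem_toProg {S : Type u} (I : Interp S) (D : FTS S) : D.toProg.sem I = D := by
  cases D with
  | mk init next fair =>
    have h : (fair.map fun J => (Fml.atom fun v => J (v 0) : Asrt S 0)).map (Fml.eval I) = fair :=
      List.map_map.trans (List.map_id fair)
    exact congrArg (FTS.mk init next) h

theorem StateFormula.map_eval_embed {S : Type u} (I : Interp S) (φ : StateFormula (S → Prop)) :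
    φ.embed.map (Fml.eval I) = φ :=
  (StateFormula.map_map _ _ φ).trans (StateFormula.map_id φ)

/-- `D` satisfies `φ`, both read under the interpretation `I`. -/
def Prog.Valid {S : Type u} (I : Interp S) {n : ℕ} (D : Prog S n)
    (φ : StateFormula (Asrt S n)) : Prop :=
  (D.sem I).Satisfies (φ.map (Fml.eval I))

/-! ### Elimination of temporal operators -/

theorem PathFormula.sat_map_weaken {S : Type u} (I : Interp S) {n : ℕ} (D : FTS (State S n))
    (D' : FTS (State S (n + 1))) {ψ : PathFormula (Asrt S n)} (hψ : ψ.QuantFree)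
    (σ : ℕ → State S (n + 1)) :
    ((ψ.map Fml.weaken).map (Fml.eval I)).Sat D' σ ↔
      (ψ.map (Fml.eval I)).Sat D (fun i => (σ i).1) := by
  rw [PathFormula.map_map]
  exact PathFormula.sat_map_comp (f := Fml.eval I ∘ Fml.weaken) (e := Fml.eval I)
    (g := (Prod.fst : State S (n + 1) → State S n)) (fun _ _ => Iff.rfl) D D' ψ hψ σ

/-- If the new variable implies the eliminated formula along `σ`, then `ψ (x)` implies `ψ`. -/
theorem PathFormula.sat_of_sat_elim {S : Type u} {I : Interp S} {n : ℕ} {D : FTS (State S n)}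
    {D' : FTS (State S (n + 1))} {ψ old : PathFormula (Asrt S n)} (hψ : ψ.QuantFree)
    (hold : old.QuantFree) {σ : ℕ → State S (n + 1)}
    (h : ∀ k, (σ k).2 = true → (old.map (Fml.eval I)).Sat D (fun i => (σ (i + k)).1))
    (hs : ((ψ.elim old).map (Fml.eval I)).Sat D' σ) :
    (ψ.map (Fml.eval I)).Sat D (fun i => (σ i).1) := by
  rw [← PathFormula.sat_map_weaken I D D' hψ]
  refine PathFormula.sat_of_sat_replace _ σ (fun k hk => ?_) hs
  rw [PathFormula.sat_map_weaken I D D' hold]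
  refine h k ?_
  have hk' : (σ (0 + k)).2 = true := hk
  rwa [Nat.zero_add] at hk'

mutual
theorem StateFormula.quantFree_of_assertion? {S : Type u} {n : ℕ} :
    ∀ {φ : StateFormula (Asrt S n)} {c : Asrt S n}, φ.assertion? = some c → φ.QuantFree
  | .asrt _, _, _ => trivial
  | .and _ _, _, h => by
    obtain ⟨_, _, h₁, h₂, -⟩ := Option.map₂_eq_some_iff.1 h
    exact ⟨StateFormula.quantFree_of_assertion? h₁, StateFormula.quantFree_of_assertion? h₂⟩
  | .or _ _, _, h => by
    obtain ⟨_, _, h₁, h₂, -⟩ := Option.map₂_eq_some_iff.1 h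
    exact ⟨StateFormula.quantFree_of_assertion? h₁, StateFormula.quantFree_of_assertion? h₂⟩
  | .quant _ _, _, h => by cases h
theorem PathFormula.quantFree_of_assertion? {S : Type u} {n : ℕ} :
    ∀ {ψ : PathFormula (Asrt S n)} {c : Asrt S n}, ψ.assertion? = some c → ψ.QuantFree
  | .state _, _, h => StateFormula.quantFree_of_assertion? h
  | .and _ _, _, h => by
    obtain ⟨_, _, h₁, h₂, -⟩ := Option.map₂_eq_some_iff.1 h
    exact ⟨PathFormula.quantFree_of_assertion? h₁, PathFormula.quantFree_of_assertion? h₂⟩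
  | .or _ _, _, h => by
    obtain ⟨_, _, h₁, h₂, -⟩ := Option.map₂_eq_some_iff.1 h
    exact ⟨PathFormula.quantFree_of_assertion? h₁, PathFormula.quantFree_of_assertion? h₂⟩
  | .next _, _, h => by cases h
  | .glob _, _, h => by cases h
  | .untl _ _, _, h => by cases h
end

/-- Elimination under `A_f` is sound if every fair path of `D` lifts to a fair path of `D'` along
which the new variable implies the eliminated formula. -/
theorem valid_Af_of_elim {S : Type u} {I : Interp S} {n : ℕ} {D : Prog S n} {D' : Prog S (n + 1)}
    {ψ old : PathFormula (Asrt S n)} (hψ : ψ.QuantFree) (hold : old.QuantFree)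
    (hinit : D'.init = .weaken D.init)
    (hlift : ∀ π, (D.sem I).IsFairPath π → ∃ x : ℕ → Bool,
      (D'.sem I).IsFairPath (fun i => (π i, x i)) ∧
      ∀ k, x k = true → (old.map (Fml.eval I)).Sat (D.sem I) (fun i => π (i + k)))
    (h : D'.Valid I (.quant .Af (ψ.elim old))) : D.Valid I (.quant .Af ψ) := by
  rintro s hs π hπ rfl
  obtain ⟨x, hx, himp⟩ := hlift π hπ
  have hi : (D'.sem I).init (π 0, x 0) := by
    change Fml.eval I D'.init _
    rw [hinit]
    exact hs
  exact PathFormula.sat_of_sat_elim hψ hold himp (h _ hi _ hx rfl)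

/-- Elimination under `E_f` is sound if every fair path of `D'` projects to a fair path of `D`, and
the new variable implies the eliminated formula along it. -/
theorem valid_Ef_of_elim {S : Type u} {I : Interp S} {n : ℕ} {D : Prog S n} {D' : Prog S (n + 1)}
    {ψ old : PathFormula (Asrt S n)} (hψ : ψ.QuantFree) (hold : old.QuantFree) {aux : ℕ}
    (haux : (auxClause D aux).Holds I)
    (hproj : ∀ σ, (D'.sem I).IsFairPath σ → (D.sem I).IsFairPath (fun i => (σ i).1) ∧
      ∀ k, (σ k).2 = true → (old.map (Fml.eval I)).Sat (D.sem I) (fun i => (σ (i + k)).1))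
    (h : (D'.withInit aux).Valid I (.quant .Ef (ψ.elim old))) : D.Valid I (.quant .Ef ψ) := by
  intro s hs
  obtain ⟨b, hb⟩ := haux (fun _ => s) hs
  obtain ⟨σ, hσ, h0, hsat⟩ := h (s, b 0) hb
  obtain ⟨hfair, himp⟩ := hproj σ hσ
  exact ⟨_, hfair, congrArg Prod.fst h0, PathFormula.sat_of_sat_elim hψ hold himp hsat⟩

theorem Prog.sem_extend_isPath {S : Type u} (I : Interp S) {n : ℕ} (D : Prog S n)
    (e : Fml S (n + 1) 2) (σ : ℕ → State S (n + 1)) :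
    ((D.extend e).sem I).IsPath σ ↔ (D.sem I).IsPath (fun i => (σ i).1) ∧
      ∀ i, (σ i).2 = true ↔ e.Holds I ![σ i, σ (i + 1)] := by
  have h : ∀ i, (fun j => ((![σ i, σ (i + 1)] : Fin 2 → State S (n + 1)) j).1) =
      ![(σ i).1, (σ (i + 1)).1] := fun i => by
    funext j
    fin_cases j <;> rfl
  refine Iff.trans (forall_congr' fun i => ?_) forall_and
  refine and_congr ?_ Iff.rfl
  exact iff_of_eq (congrArg (D.next.Holds I) (h i))

theorem Prog.sem_isFairPath {S : Type u} (I : Interp S) {n : ℕ} (D : Prog S n)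
    (π : ℕ → State S n) : (D.sem I).IsFairPath π ↔
      (D.sem I).IsPath π ∧ ∀ J ∈ D.fair, ∀ i, ∃ j, i ≤ j ∧ J.eval I (π j) := by
  simp [FTS.IsFairPath, Prog.sem]

theorem Prog.sem_extend_isFairPath {S : Type u} (I : Interp S) {n : ℕ} (D : Prog S n)
    (e : Fml S (n + 1) 2) (σ : ℕ → State S (n + 1)) :
    ((D.extend e).sem I).IsFairPath σ ↔ (D.sem I).IsFairPath (fun i => (σ i).1) ∧
      ∀ i, (σ i).2 = true ↔ e.Holds I ![σ i, σ (i + 1)] := by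
  have h : (∀ J ∈ (D.extend e).fair, ∀ i, ∃ j, i ≤ j ∧ J.eval I (σ j)) ↔
      ∀ J ∈ D.fair, ∀ i, ∃ j, i ≤ j ∧ J.eval I (σ j).1 :=
    List.forall_mem_map
  rw [Prog.sem_isFairPath, Prog.sem_isFairPath, Prog.sem_extend_isPath, h]
  tauto

theorem Prog.sem_addFair_isFairPath {S : Type u} (I : Interp S) {n : ℕ} (D : Prog S n)
    (J : Asrt S n) (π : ℕ → State S n) :
    ((D.addFair J).sem I).IsFairPath π ↔ (D.sem I).IsFairPath π ∧
      ∀ i, ∃ j, i ≤ j ∧ J.eval I (π j) := by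
  have h : (∀ K ∈ (D.addFair J).fair, ∀ i, ∃ j, i ≤ j ∧ K.eval I (π j)) ↔
      (∀ K ∈ D.fair, ∀ i, ∃ j, i ≤ j ∧ K.eval I (π j)) ∧ ∀ i, ∃ j, i ≤ j ∧ J.eval I (π j) := by
    simp [Prog.addFair, or_imp, forall_and]
  rw [Prog.sem_isFairPath, Prog.sem_isFairPath, h, and_assoc]
  exact Iff.rfl

theorem Prog.sem_extX_isFairPath {S : Type u} (I : Interp S) {n : ℕ} (D : Prog S n)
    (c : Asrt S n) (σ : ℕ → State S (n + 1)) :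
    ((D.extX c).sem I).IsFairPath σ ↔ (D.sem I).IsFairPath (fun i => (σ i).1) ∧
      ∀ i, (σ i).2 = true ↔ c.eval I (σ (i + 1)).1 :=
  Prog.sem_extend_isFairPath I D _ σ

theorem Prog.sem_extG_isFairPath {S : Type u} (I : Interp S) {n : ℕ} (D : Prog S n)
    (c : Asrt S n) (σ : ℕ → State S (n + 1)) :
    ((D.extG c).sem I).IsFairPath σ ↔ ((D.sem I).IsFairPath (fun i => (σ i).1) ∧
      ∀ i, (σ i).2 = true ↔ c.eval I (σ i).1 ∧ (σ (i + 1)).2 = true) ∧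
      ∀ i, ∃ j, i ≤ j ∧ ((σ j).2 = true ∨ ¬ c.eval I (σ j).1) :=
  (Prog.sem_addFair_isFairPath I _ _ σ).trans
    (and_congr (Prog.sem_extend_isFairPath I D _ σ) Iff.rfl)

theorem Prog.sem_extU_isFairPath {S : Type u} (I : Interp S) {n : ℕ} (D : Prog S n)
    (c₁ c₂ : Asrt S n) (σ : ℕ → State S (n + 1)) :
    ((D.extU c₁ c₂).sem I).IsFairPath σ ↔ ((D.sem I).IsFairPath (fun i => (σ i).1) ∧
      ∀ i, (σ i).2 = true ↔ c₂.eval I (σ i).1 ∨ c₁.eval I (σ i).1 ∧ (σ (i + 1)).2 = true) ∧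
      ∀ i, ∃ j, i ≤ j ∧ (¬ (σ j).2 = true ∨ c₂.eval I (σ j).1) :=
  (Prog.sem_addFair_isFairPath I _ _ σ).trans
    (and_congr (Prog.sem_extend_isFairPath I D _ σ) Iff.rfl)

section Operators

variable {S : Type u} {I : Interp S} {n : ℕ} (D : FTS (State S n))
  {ξ ξ₁ ξ₂ : PathFormula (Asrt S n)} {c c₁ c₂ : Asrt S n} (π : ℕ → State S n) (k : ℕ)

theorem sat_next_iff (h : ξ.assertion? = some c) :
    ((PathFormula.next ξ).map (Fml.eval I)).Sat D (fun i => π (i + k)) ↔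
      c.eval I (π (k + 1)) := by
  refine (PathFormula.sat_of_assertion? D h _).trans ?_
  rw [show k + 1 = 0 + 1 + k by omega]

theorem sat_glob_iff (h : ξ.assertion? = some c) :
    ((PathFormula.glob ξ).map (Fml.eval I)).Sat D (fun i => π (i + k)) ↔
      ∀ j, k ≤ j → c.eval I (π j) := by
  refine (forall_congr' fun l => PathFormula.sat_of_assertion? D h _).trans
    ⟨fun H j hj => ?_, fun H l => H _ (by omega)⟩
  rw [show j = 0 + (j - k) + k by omega]
  exact H (j - k)

theorem sat_untl_iff (h₁ : ξ₁.assertion? = some c₁) (h₂ : ξ₂.assertion? = some c₂) :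
    ((PathFormula.untl ξ₁ ξ₂).map (Fml.eval I)).Sat D (fun i => π (i + k)) ↔
      ∃ l, k ≤ l ∧ c₂.eval I (π l) ∧ ∀ j, k ≤ j → j < l → c₁.eval I (π j) := by
  refine (exists_congr fun l => and_congr (PathFormula.sat_of_assertion? D h₂ _)
    (forall_congr' fun j => imp_congr_right fun _ =>
      PathFormula.sat_of_assertion? D h₁ _)).trans ⟨?_, ?_⟩
  · rintro ⟨l, hl, H⟩
    refine ⟨0 + l + k, by omega, hl, fun j hkj hjl => ?_⟩
    rw [show j = 0 + (j - k) + k by omega]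
    exact H (j - k) (by omega)
  · rintro ⟨l, hkl, hl, H⟩
    refine ⟨l - k, ?_, fun j hj => H _ (by omega) (by omega)⟩
    rw [show l = 0 + (l - k) + k by omega] at hl
    exact hl

end Operators

/-- Every solution `x` of the recursion for `G c` implies `G c`. -/
theorem forall_of_glob_rec {c x : ℕ → Prop} (hrec : ∀ i, x i ↔ c i ∧ x (i + 1)) {k : ℕ}
    (hk : x k) : ∀ j, k ≤ j → c j := by
  have hx : ∀ j, k ≤ j → x j := fun j hj => by
    induction j, hj using Nat.le_induction with
    | base => exact hk
    | succ j _ ih => exact ((hrec j).1 ih).2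
  exact fun j hj => ((hrec j).1 (hx j hj)).1

/-- A solution of the recursion for `c₁ U c₂` implies it if the eventuality is not postponed
forever. -/
theorem exists_of_untl_rec {c₁ c₂ x : ℕ → Prop} (hrec : ∀ i, x i ↔ c₂ i ∨ c₁ i ∧ x (i + 1))
    (hfair : ∀ i, ∃ j, i ≤ j ∧ (¬ x j ∨ c₂ j)) {k : ℕ} (hk : x k) :
    ∃ l, k ≤ l ∧ c₂ l ∧ ∀ j, k ≤ j → j < l → c₁ j := by
  obtain ⟨m, hkm, hm⟩ := hfair k
  obtain ⟨d, rfl⟩ := Nat.exists_eq_add_of_le hkm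
  induction d generalizing k with
  | zero => exact ⟨k, le_rfl, hm.resolve_left (not_not_intro hk), fun j _ _ => by omega⟩
  | succ d ih =>
    rcases (hrec k).1 hk with h | ⟨h₁, hx⟩
    · exact ⟨k, le_rfl, h, fun j _ _ => by omega⟩
    · obtain ⟨l, hl, h₂, H⟩ := ih hx (by omega)
        (by rwa [show k + 1 + d = k + (d + 1) by omega])
      refine ⟨l, by omega, h₂, fun j hkj hjl => ?_⟩
      rcases hkj.eq_or_lt with rfl | hlt
      · exact h₁
      · exact H j hlt hjl

/-! ### Lifting and projecting fair paths -/

theorem lift_extX {S : Type u} {I : Interp S} {n : ℕ} {D : Prog S n}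
    {ξ : PathFormula (Asrt S n)} {c : Asrt S n} (h : ξ.assertion? = some c)
    (π : ℕ → State S n) (hπ : (D.sem I).IsFairPath π) : ∃ x : ℕ → Bool,
      ((D.extX c).sem I).IsFairPath (fun i => (π i, x i)) ∧
      ∀ k, x k = true →
        ((PathFormula.next ξ).map (Fml.eval I)).Sat (D.sem I) (fun i => π (i + k)) := by
  classical
  refine ⟨fun i => decide (c.eval I (π (i + 1))), ?_, fun k hk => ?_⟩
  · exact (Prog.sem_extX_isFairPath I D c _).2 ⟨hπ, fun i => decide_eq_true_iff⟩
  · exact (sat_next_iff _ π k h).2 (of_decide_eq_true hk)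

theorem lift_extG {S : Type u} {I : Interp S} {n : ℕ} {D : Prog S n}
    {ξ : PathFormula (Asrt S n)} {c : Asrt S n} (h : ξ.assertion? = some c)
    (π : ℕ → State S n) (hπ : (D.sem I).IsFairPath π) : ∃ x : ℕ → Bool,
      ((D.extG c).sem I).IsFairPath (fun i => (π i, x i)) ∧
      ∀ k, x k = true →
        ((PathFormula.glob ξ).map (Fml.eval I)).Sat (D.sem I) (fun i => π (i + k)) := by
  classical
  refine ⟨fun i => decide (∀ j, i ≤ j → c.eval I (π j)), ?_, fun k hk => ?_⟩
  · refine (Prog.sem_extG_isFairPath I D c _).2 ⟨⟨hπ, fun i => ?_⟩, fun i => ?_⟩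
    · simp only [decide_eq_true_iff]
      refine ⟨fun H => ⟨H i le_rfl, fun j hj => H j (by omega)⟩, fun H j hj => ?_⟩
      rcases hj.eq_or_lt with rfl | hlt
      · exact H.1
      · exact H.2 j hlt
    · simp only [decide_eq_true_iff]
      by_cases H : ∀ j, i ≤ j → c.eval I (π j)
      · exact ⟨i, le_rfl, .inl H⟩
      · push Not at H
        obtain ⟨j, hj, hc⟩ := H
        exact ⟨j, hj, .inr hc⟩
  · exact (sat_glob_iff _ π k h).2 (of_decide_eq_true hk)

theorem lift_extU {S : Type u} {I : Interp S} {n : ℕ} {D : Prog S n}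
    {ξ₁ ξ₂ : PathFormula (Asrt S n)} {c₁ c₂ : Asrt S n} (h₁ : ξ₁.assertion? = some c₁)
    (h₂ : ξ₂.assertion? = some c₂)
    (π : ℕ → State S n) (hπ : (D.sem I).IsFairPath π) : ∃ x : ℕ → Bool,
      ((D.extU c₁ c₂).sem I).IsFairPath (fun i => (π i, x i)) ∧
      ∀ k, x k = true →
        ((PathFormula.untl ξ₁ ξ₂).map (Fml.eval I)).Sat (D.sem I) (fun i => π (i + k)) := by
  classical
  refine ⟨fun i => decide (∃ l, i ≤ l ∧ c₂.eval I (π l) ∧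
    ∀ j, i ≤ j → j < l → c₁.eval I (π j)), ?_, fun k hk => ?_⟩
  · refine (Prog.sem_extU_isFairPath I D c₁ c₂ _).2 ⟨⟨hπ, fun i => ?_⟩, fun i => ?_⟩
    · simp only [decide_eq_true_iff]
      constructor
      · rintro ⟨l, hl, hc, H⟩
        rcases hl.eq_or_lt with rfl | hlt
        · exact .inl hc
        · exact .inr ⟨H i le_rfl hlt, l, hlt, hc, fun j hj => H j (by omega)⟩
      · rintro (hc | ⟨hc, l, hl, hc₂, H⟩)
        · exact ⟨i, le_rfl, hc, fun j _ _ => by omega⟩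
        · refine ⟨l, by omega, hc₂, fun j hij hjl => ?_⟩
          rcases hij.eq_or_lt with rfl | hlt
          · exact hc
          · exact H j hlt hjl
    · simp only [decide_eq_true_iff]
      by_cases H : ∃ l, i ≤ l ∧ c₂.eval I (π l) ∧ ∀ j, i ≤ j → j < l → c₁.eval I (π j)
      · obtain ⟨l, hl, hc, -⟩ := H
        exact ⟨l, hl, .inr hc⟩
      · exact ⟨i, le_rfl, .inl H⟩
  · exact (sat_untl_iff _ π k h₁ h₂).2 (of_decide_eq_true hk)

theorem proj_extX {S : Type u} {I : Interp S} {n : ℕ} {D : Prog S n}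
    {ξ : PathFormula (Asrt S n)} {c : Asrt S n} (h : ξ.assertion? = some c)
    (σ : ℕ → State S (n + 1)) (hσ : ((D.extX c).sem I).IsFairPath σ) :
    (D.sem I).IsFairPath (fun i => (σ i).1) ∧ ∀ k, (σ k).2 = true →
      ((PathFormula.next ξ).map (Fml.eval I)).Sat (D.sem I) (fun i => (σ (i + k)).1) := by
  obtain ⟨hD, hx⟩ := (Prog.sem_extX_isFairPath I D c σ).1 hσ
  exact ⟨hD, fun k hk => (sat_next_iff _ (fun i => (σ i).1) k h).2 ((hx k).1 hk)⟩

theorem proj_extG {S : Type u} {I : Interp S} {n : ℕ} {D : Prog S n}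
    {ξ : PathFormula (Asrt S n)} {c : Asrt S n} (h : ξ.assertion? = some c)
    (σ : ℕ → State S (n + 1)) (hσ : ((D.extG c).sem I).IsFairPath σ) :
    (D.sem I).IsFairPath (fun i => (σ i).1) ∧ ∀ k, (σ k).2 = true →
      ((PathFormula.glob ξ).map (Fml.eval I)).Sat (D.sem I) (fun i => (σ (i + k)).1) := by
  obtain ⟨⟨hD, hx⟩, -⟩ := (Prog.sem_extG_isFairPath I D c σ).1 hσ
  exact ⟨hD, fun k hk => (sat_glob_iff _ (fun i => (σ i).1) k h).2 (forall_of_glob_rec hx hk)⟩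

theorem proj_extU {S : Type u} {I : Interp S} {n : ℕ} {D : Prog S n}
    {ξ₁ ξ₂ : PathFormula (Asrt S n)} {c₁ c₂ : Asrt S n} (h₁ : ξ₁.assertion? = some c₁)
    (h₂ : ξ₂.assertion? = some c₂)
    (σ : ℕ → State S (n + 1)) (hσ : ((D.extU c₁ c₂).sem I).IsFairPath σ) :
    (D.sem I).IsFairPath (fun i => (σ i).1) ∧ ∀ k, (σ k).2 = true →
      ((PathFormula.untl ξ₁ ξ₂).map (Fml.eval I)).Sat (D.sem I) (fun i => (σ (i + k)).1) := by
  obtain ⟨⟨hD, hx⟩, hf⟩ := (Prog.sem_extU_isFairPath I D c₁ c₂ σ).1 hσ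
  exact ⟨hD, fun k hk =>
    (sat_untl_iff _ (fun i => (σ i).1) k h₁ h₂).2 (exists_of_untl_rec hx hf hk)⟩

/-! ### Replacement of basic formulas by predicates -/

/-- The initial condition is irrelevant for the satisfaction of a basic formula in a state. -/
theorem sat_quant_withInit {S : Type u} {I : Interp S} {n : ℕ} {D : Prog S n} {aux : ℕ}
    {Q : Quant} {ψ : PathFormula (Asrt S n)} (hψ : ψ.QuantFree) (s : State S n) :
    ((StateFormula.quant Q ψ).map (Fml.eval I)).Sat ((D.withInit aux).sem I) s ↔
      ((StateFormula.quant Q ψ).map (Fml.eval I)).Sat (D.sem I) s := by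
  have h := PathFormula.sat_map_comp (f := Fml.eval I) (e := Fml.eval I) (g := id)
    (fun _ _ => Iff.rfl) (D.sem I) ((D.withInit aux).sem I) ψ hψ
  cases Q with
  | A => exact forall_congr' fun π => imp_congr_right fun _ => imp_congr_right fun _ => h π
  | E => exact exists_congr fun π => and_congr_right fun _ => and_congr_right fun _ => h π
  | Af => exact forall_congr' fun π => imp_congr_right fun _ => imp_congr_right fun _ => h π
  | Ef => exact exists_congr fun π => and_congr_right fun _ => and_congr_right fun _ => h π

theorem valid_of_replace {S : Type u} {I : Interp S} {n : ℕ} {D : Prog S n} {aux : ℕ}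
    {Q : Quant} {ψ : PathFormula (Asrt S n)} {φ : StateFormula (Asrt S n)} (hψ : ψ.QuantFree)
    (h₁ : (D.withInit aux).Valid I (.quant Q ψ))
    (h₂ : D.Valid I (φ.replace Q ψ (.asrt (.pred₁ aux 0)))) : D.Valid I φ := by
  refine fun s hs => StateFormula.sat_of_sat_replace (fun s' h => ?_) φ s (h₂ s hs)
  exact (sat_quant_withInit hψ s').1 (h₁ s' h)

theorem Prog.sem_dropFair_isFairPath {S : Type u} (I : Interp S) {n : ℕ} (D : Prog S n)
    (π : ℕ → State S n) : (D.dropFair.sem I).IsFairPath π ↔ (D.sem I).IsPath π := by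
  refine (Prog.sem_isFairPath I _ π).trans (and_iff_left ?_)
  simp [Prog.dropFair]

theorem valid_A_of_dropFair {S : Type u} {I : Interp S} {n : ℕ} {D : Prog S n}
    {ψ : PathFormula (Asrt S n)} (hψ : ψ.QuantFree)
    (h : D.dropFair.Valid I (.quant .Af ψ)) : D.Valid I (.quant .A ψ) := by
  intro s hs π hπ h0
  have := h s hs π ((Prog.sem_dropFair_isFairPath I D π).2 hπ) h0
  exact (PathFormula.sat_map_comp (g := id) (fun _ _ => Iff.rfl) _ _ ψ hψ π).1 this

theorem valid_E_of_dropFair {S : Type u} {I : Interp S} {n : ℕ} {D : Prog S n}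
    {ψ : PathFormula (Asrt S n)} (hψ : ψ.QuantFree)
    (h : D.dropFair.Valid I (.quant .Ef ψ)) : D.Valid I (.quant .E ψ) := by
  intro s hs
  obtain ⟨π, hπ, h0, hsat⟩ := h s hs
  exact ⟨π, (Prog.sem_dropFair_isFairPath I D π).1 hπ, h0,
    (PathFormula.sat_map_comp (g := id) (fun _ _ => Iff.rfl) _ _ ψ hψ π).1 hsat⟩

/-! ### Fair paths and assertions on the initial state -/

/-- Along a path from an initial state violating `c`, the predicate `p` holds everywhere and `t`
links every state to all later ones. -/
theorem inv_of_clausesAf {S : Type u} {I : Interp S} {n : ℕ} {D : Prog S n} {c : Asrt S n}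
    {p r t : ℕ} (hC : ∀ C ∈ clausesAf D c p r t, C.Holds I) {π : ℕ → State S n}
    (hπ : (D.sem I).IsPath π) (hinit : D.init.eval I (π 0)) (hc : ¬ c.eval I (π 0)) :
    (∀ i, I n 1 p (fun _ => π i)) ∧ ∀ i j, i < j → I n 2 t ![π i, π j] := by
  have h1 := hC (.imp (.and D.init (.not c)) (.pred₁ p 0)) (by simp [clausesAf])
  have h2 := hC (.imp (.and D.next (.pred₁ p 0)) (.pred₁ p 1)) (by simp [clausesAf])
  have h3 := hC (.imp D.next (.pred₂ t 0 1)) (by simp [clausesAf])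
  have h4 := hC (.imp (k := 3) (.and (.pred₂ t 0 1) (.subst ![1, 2] D.next)) (.pred₂ t 0 2))
    (by simp [clausesAf])
  refine ⟨fun i => ?_, fun i j hij => ?_⟩
  · induction i with
    | zero => exact h1 (fun _ => π 0) ⟨hinit, hc⟩
    | succ i ih => exact h2 ![π i, π (i + 1)] ⟨hπ i, ih⟩
  · induction j, hij using Nat.le_induction with
    | base => exact (Fml.holds_pred₂ I t 0 1 _).1 (h3 ![π i, π (i + 1)] (hπ i))
    | succ j _ ih =>
      refine (Fml.holds_pred₂ I t 0 2 _).1 (h4 ![π i, π j, π (j + 1)]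
        ⟨(Fml.holds_pred₂ I t 0 1 _).2 ih, ?_⟩)
      have : (fun l => (![π i, π j, π (j + 1)] : Fin 3 → State S n)
          ((![1, 2] : Fin 2 → Fin 3) l)) = ![π j, π (j + 1)] := by
        funext l
        fin_cases l <;> rfl
      exact (congrArg (D.next.Holds I) this).mpr (hπ j)

theorem dwf_of_clausesAf {S : Type u} {I : Interp S} {n : ℕ} {D : Prog S n} {c : Asrt S n}
    {p r t : ℕ} (hC : ∀ C ∈ clausesAf D c p r t, C.Holds I) :
    DisjWellFounded (fun x y : State S n => I n 2 r ![x, y]) :=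
  hC (.dwf n r) (by simp [clausesAf])

theorem valid_Af_of_clauses_noFair {S : Type u} {I : Interp S} {n : ℕ} {D : Prog S n}
    {ψ : PathFormula (Asrt S n)} {c : Asrt S n} {p r t : ℕ} (hψ : ψ.assertion? = some c)
    (hC : ∀ C ∈ clausesAf D c p r t, C.Holds I) (hr : (clauseAfNoFair S n p r t).Holds I) :
    D.Valid I (.quant .Af ψ) := by
  rintro s hs π hπ rfl
  refine (PathFormula.sat_of_assertion? _ hψ π).2 (by_contra fun hc => ?_)
  obtain ⟨hp, ht⟩ := inv_of_clausesAf hC hπ.1 hs hc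
  refine (dwf_of_clausesAf hC).not_forall_lt π fun i j hij => ?_
  exact (Fml.holds_pred₂ I r 0 1 _).1
    (hr ![π i, π j] ⟨hp i, (Fml.holds_pred₂ I t 0 1 _).2 (ht i j hij)⟩)

theorem valid_Af_of_clauses_fair {S : Type u} {I : Interp S} {n : ℕ} {D : Prog S n}
    {ψ : PathFormula (Asrt S n)} {c : Asrt S n} {p r t : ℕ} (hψ : ψ.assertion? = some c)
    (hD : D.fair ≠ []) (hC : ∀ C ∈ clausesAf D c p r t, C.Holds I)
    (hr : (clauseAfFair D p r t).Holds I) : D.Valid I (.quant .Af ψ) := by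
  rintro s hs π hπ rfl
  refine (PathFormula.sat_of_assertion? _ hψ π).2 (by_contra fun hc => ?_)
  obtain ⟨hp, ht⟩ := inv_of_clausesAf hC hπ.1 hs hc
  refine not_forall_fair_of_disjWellFounded (m := D.fair.length)
    (J := fun i s => (D.fair.get i).eval I s) (p := fun s => I n 1 p (fun _ => s))
    (t := fun x y => I n 2 t ![x, y]) (List.length_pos_of_ne_nil hD) (dwf_of_clausesAf hC)
    (fun v hv H => ?_) hp ht
    fun i N => ((Prog.sem_isFairPath I D π).1 hπ).2 _ (List.get_mem _ i) N
  exact (Fml.holds_pred₂ I r 0 _ v).1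
    (hr v ⟨hv, fun i => ⟨(Fml.holds_pred₂ I t _ _ v).2 (H i).1, (H i).2⟩⟩)

theorem holds_ex_next {S : Type u} {I : Interp S} {n : ℕ} {D : Prog S n} {s : State S n}
    {φ : Fml S n 2} (h : (Fml.ex (k := 1) (.and D.next φ)).Holds I (fun _ => s)) :
    ∃ s', (D.sem I).next s s' ∧ φ.Holds I ![s, s'] := by
  obtain ⟨s', h⟩ := h
  have : Fin.snoc (α := fun _ : Fin 2 => State S n) (fun _ : Fin 1 => s) s' = ![s, s'] := by
    funext l
    fin_cases l <;> rfl
  rw [this] at h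
  exact ⟨s', h⟩

theorem valid_Ef_of_clauses_noFair {S : Type u} {I : Interp S} {n : ℕ} {D : Prog S n}
    {ψ : PathFormula (Asrt S n)} {c : Asrt S n} {q : ℕ} (hψ : ψ.assertion? = some c)
    (hD : D.fair = []) (hC : ∀ C ∈ clausesEfNoFair D c q, C.Holds I) :
    D.Valid I (.quant .Ef ψ) := by
  have h1 := hC (.imp D.init (.and c (.pred₁ q 0))) (by simp [clausesEfNoFair])
  have h2 := hC (.imp (k := 1) (.pred₁ q 0) (.ex (.and D.next (.pred₁ q 1))))
    (by simp [clausesEfNoFair])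
  have hstep : ∀ s : {s : State S n // I n 1 q (fun _ => s)},
      ∃ s' : {s : State S n // I n 1 q (fun _ => s)}, (D.sem I).next s.1 s'.1 := fun s => by
    obtain ⟨s', hn, hq⟩ := holds_ex_next (h2 (fun _ => s.1) s.2)
    exact ⟨⟨s', hq⟩, hn⟩
  choose f hf using hstep
  intro s hs
  obtain ⟨hc, hq⟩ := h1 (fun _ => s) hs
  let z : ℕ → {s : State S n // I n 1 q (fun _ => s)} := fun i => Nat.rec ⟨s, hq⟩ (fun _ => f) i
  refine ⟨fun i => (z i).1, ?_, rfl, (PathFormula.sat_of_assertion? _ hψ _).2 hc⟩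
  refine (Prog.sem_isFairPath I D _).2 ⟨fun i => hf (z i), ?_⟩
  simp [hD]

theorem valid_Ef_of_clauses_fair {S : Type u} {I : Interp S} {n : ℕ} {D : Prog S n}
    {ψ : PathFormula (Asrt S n)} {c : Asrt S n} (hJ : 0 < D.fair.length)
    {q r : Fin D.fair.length → ℕ} (hψ : ψ.assertion? = some c)
    (hC : ∀ C ∈ clausesEfFair D hJ c q r, C.Holds I) : D.Valid I (.quant .Ef ψ) := by
  have hmem := fun i C h => hC C (.inr (Set.mem_iUnion.2 ⟨i, h⟩))
  intro s hs
  obtain ⟨hc, hq⟩ := hC _ (.inl rfl) (fun _ => s) hs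
  obtain ⟨π, h0, hn, hfair⟩ := exists_fair_path_of_disjWellFounded hJ
    (next := (D.sem I).next) (J := fun i s => (D.fair.get i).eval I s)
    (q := fun i s => I n 1 (q i) (fun _ => s)) (r := fun i x y => I n 2 (r i) ![x, y])
    (fun i v hv => by
      obtain ⟨v', hv', h⟩ := holds_ex_next (hmem i _ (.inl rfl) (fun _ => v) hv)
      exact ⟨v', hv', Or.imp_right (And.imp_left (Fml.holds_pred₂ I (r i) 0 1 _).1) h⟩)
    (fun i => hmem i _ (.inr (.inl rfl)))
    (fun i x y z hxy hyz => (Fml.holds_pred₂ I (r i) 0 2 _).1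
      (hmem i _ (.inr (.inr rfl)) ![x, y, z]
        ⟨(Fml.holds_pred₂ I (r i) 0 1 _).2 hxy, (Fml.holds_pred₂ I (r i) 1 2 _).2 hyz⟩))
    hq
  refine ⟨π, (Prog.sem_isFairPath I D π).2 ⟨hn, fun J hJ => ?_⟩, h0,
    (PathFormula.sat_of_assertion? _ hψ π).2 (h0 ▸ hc)⟩
  obtain ⟨i, rfl⟩ := List.get_of_mem hJ
  exact hfair i

/-! ### Soundness -/

theorem Trans.sound {S : Type u} {I : Interp S} {n : ℕ} {U U' : Set ℕ} {D : Prog S n}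
    {φ : StateFormula (Asrt S n)} {C : Set (Clause S)} (h : Trans U D φ C U')
    (hI : ∀ c ∈ C, c.Holds I) : D.Valid I φ := by
  induction h with
  | rule1 hψ _ _ _ _ ih₁ ih₂ =>
    exact valid_of_replace hψ (ih₁ fun c hc => hI c (.inl hc)) (ih₂ fun c hc => hI c (.inr hc))
  | rule2A hψ _ ih => exact valid_A_of_dropFair hψ (ih hI)
  | rule2E hψ _ ih => exact valid_E_of_dropFair hψ (ih hI)
  | rule3A hψ hξ _ _ ih =>
    exact valid_Af_of_elim (old := .next _) hψ
      (PathFormula.quantFree_of_assertion? hξ :) rfl (lift_extX hξ) (ih hI)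
  | rule3E hψ hξ _ _ _ ih =>
    exact valid_Ef_of_elim (old := .next _) hψ
      (PathFormula.quantFree_of_assertion? hξ :) (hI _ (.inl rfl))
      (proj_extX hξ) (ih fun c hc => hI c (.inr hc))
  | rule4A hψ hξ _ _ ih =>
    exact valid_Af_of_elim (old := .glob _) hψ
      (PathFormula.quantFree_of_assertion? hξ :) rfl (lift_extG hξ) (ih hI)
  | rule4E hψ hξ _ _ _ ih =>
    exact valid_Ef_of_elim (old := .glob _) hψ
      (PathFormula.quantFree_of_assertion? hξ :) (hI _ (.inl rfl))
      (proj_extG hξ) (ih fun c hc => hI c (.inr hc))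
  | rule5A hψ hξ₁ hξ₂ _ _ ih =>
    exact valid_Af_of_elim (old := .untl _ _) hψ ⟨PathFormula.quantFree_of_assertion? hξ₁,
      PathFormula.quantFree_of_assertion? hξ₂⟩ rfl (lift_extU hξ₁ hξ₂) (ih hI)
  | rule5E hψ hξ₁ hξ₂ _ _ _ ih =>
    exact valid_Ef_of_elim (old := .untl _ _) hψ ⟨PathFormula.quantFree_of_assertion? hξ₁,
      PathFormula.quantFree_of_assertion? hξ₂⟩ (hI _ (.inl rfl))
      (proj_extU hξ₁ hξ₂) (ih fun c hc => hI c (.inr hc))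
  | rule6Fair hψ hD =>
    exact valid_Af_of_clauses_fair hψ hD (fun c hc => hI c (.inl hc)) (hI _ (.inr rfl))
  | rule6NoFair hψ =>
    exact valid_Af_of_clauses_noFair hψ (fun c hc => hI c (.inl hc)) (hI _ (.inr rfl))
  | rule7Fair hJ hψ => exact valid_Ef_of_clauses_fair hJ hψ hI
  | rule7NoFair hψ hD => exact valid_Ef_of_clauses_noFair hψ hD hI
  | rule8 hφ =>
    exact fun s hs => (StateFormula.sat_of_assertion? _ hφ s).2 (hI _ rfl (fun _ => s) hs)

end EHC

theorem theorem1 {S : Type*} (D : EHC.FTS S) (φ : EHC.StateFormula (S → Prop))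
    (C : Set (EHC.Clause S)) (hC : EHC.IsClauses D φ C) (hsat : EHC.Satisfiable C) :
    D.Satisfies φ := by
  obtain ⟨U, hT⟩ := hC
  obtain ⟨I, hI⟩ := hsat
  have h : (D.toProg.sem I).Satisfies (φ.embed.map (EHC.Fml.eval I)) := hT.sound hI
  rwa [EHC.Prog.sem_toProg, EHC.StateFormula.map_eval_embed] at h
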